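/- Let $f\in C^\infty(\mathbb R^3)$ be real valued. For $P=(p,q)\in\mathbb R^2$ and $t>0$ put $f_{(p,q,t)}(\omega)=f((p,q,0)+t\omega)$, $\omega\in\mathbf S^2$, where $\omega=(\sin\theta\cos\varphi,\sin\theta\sin\varphi,\cos\theta)$ and $d\omega$ is the surface Lebesgue measure on $\mathbf S^2$. Let $P_n$ be the Legendre polynomials and $P_{nm}(x)=(1-x^2)^{m/2}P_n^{(m)}(x)$. For $n\ge 0$, respectively $1\le m\le n$, define the Fourier coefficients $$a_{0n}(p,q,t)=\tfrac{2n+1}{4\pi}\int_{\mathbf S^2}f_{(p,q,t)}\,P_n(\cos\theta)\,d\omega,$$ $$a_{mn}(p,q,t)=\tfrac{2n+1}{2\pi}\tfrac{(n-m)!}{(n+m)!}\int_{\mathbf S^2}f_{(p,q,t)}\,P_{nm}(\cos\theta)\cos(m\varphi)\,d\omega,$$ and $b_{mn}$ likewise with $\sin(m\varphi)$ in place of $\cos(m\varphi)$. Let $\Delta=\partial_p^2+\partial_q^2$. Define real numbers $c_m(2k+1,2i)$ ($k\ge1$, $0\le i\le k$, $1\le m\le k+i$) and $s_m(2k,2j)$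 ($k\ge 1$, $0\le j\le k-1$, $1\le m\le k+j$), all of them being $0$ outside these ranges (so that $c_m(1,\cdot)=s_m(0,\cdot)=0$), recursively for $k=1,2,\dots$ as follows. With $$\sigma_{m}=\frac{c_m(2k-1,2j)}{k+j-m}-\frac{(2k-1)(k-1)(4k-1)\,s_m(2(k-1),2j)}{(4k-3)(k+j-m)},$$ $$s_m(2k,2j)=\frac{4k+1}{2k(2k+1)}\Big(\frac{(2k-1)(2k-2)\,s_m(2(k-1),2j)}{4k-3}+\sigma_m\Big)\quad(1\le m<k+j),$$ $$s_{k+j}(2k,2j)=\frac{4k+1}{2k(2k+1)}\Big(\delta_{j0}\,\frac{8k-2}{3}-\sum_{m=1}^{k+j-1}\sigma_m\Big),$$ and then, with $$\gamma_m=\frac{(4k+1)\,c_m(2k-1,2i)}{(8k-2)(k+i-m)}+(1-\delta_{i0})\frac{s_m(2k,2(i-1))}{4(k+i-m)},$$ $$c_m(2k+1,2i)=(4k+3)\Big(\frac{c_m(2k-1,2i)}{4k-1}-\gamma_m\Big)\quad(1\le m<k+i),$$ $$c_{k+i}(2k+1,2i)=(4k+3)\Big(-\delta_{i0}\,\frac{4k+1}{3}+\sum_{m=1}^{k+i-1}\gamma_m\Big).$$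 Then all derivatives and integrals below exist, namely: $a_{01}(\cdot,\cdot,u)$ is $C^\infty$ on $\mathbb R^2$ for every $u>0$, $a_{1(2k-2)}(\cdot,\cdot,t)$ and $b_{1(2k-2)}(\cdot,\cdot,t)$ are differentiable on $\mathbb R^2$ for all $k>1$ and $t>0$, and the integrands are integrable on $(0,t)$. Moreover, for all $(p,q)\in\mathbb R^2$ and $t>0$: for every integer $k>0$, $$a_{0(2k-1)}(p,q,t)=\frac{4k-1}{3}\,a_{01}(p,q,t)+\int_0^t\sum_{i=0}^{k-1}t^{2i-1}\sum_{m=1}^{k+i-1}c_m(2k-1,2i)\Big(\frac ut\Big)^{2m+1}\Delta^i a_{01}(p,q,u)\,du,$$ and for every integer $k>1$, $$\partial_p a_{1(2k-2)}(p,q,t)+\partial_q b_{1(2k-2)}(p,q,t)=\int_0^t\sum_{i=1}^{k-1}t^{2(i-1)}\sum_{m=1}^{k+i-2}s_m(2(k-1),2(i-1))\Big(\frac ut\Big)^{2m+1}\Delta^i a_{01}(p,q,u)\,du.$$ -/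

import Mathlib

open MeasureTheory

noncomputable section

namespace SphericalMeans

/-- The plane `{z = 0}`, with points `P = (p, q)`. -/
abbrev Plane : Type := EuclideanSpace ℝ (Fin 2)

/-- The space `ℝ³`, with points `(x, y, z)`. -/
abbrev Space : Type := EuclideanSpace ℝ (Fin 3)

/-- The unit sphere `S²` of `ℝ³`. -/
abbrev S2 : Type := Metric.sphere (0 : Space) 1

/-- The surface Lebesgue measure on `S²` (of total mass `4π`). -/
def surface : Measure S2 := (volume : Measure Space).toSphere

/-- The point `(p, q, 0)` of `ℝ³`. -/
def embed (P : Plane) : Space := !₂[P 0, P 1, 0]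

/-- The polar angle `θ ∈ [0, π]` of `ω ∈ S²`, measured from the `z`-axis. -/
def polar (ω : S2) : ℝ := Real.arccos ((ω : Space) 2)

/-- The azimuthal angle `φ` of `ω ∈ S²`, so that `ω = (sin θ cos φ, sin θ sin φ, cos θ)`. -/
def azimuth (ω : S2) : ℝ := Complex.arg ⟨(ω : Space) 0, (ω : Space) 1⟩

/-- The Legendre polynomial `P_n`, by Rodrigues' formula. -/
def legendre (n : ℕ) : Polynomial ℝ :=
  Polynomial.C (1 / (2 ^ n * (n.factorial : ℝ))) *
    (Polynomial.derivative^[n] ((Polynomial.X ^ 2 - 1) ^ n))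

/-- The associated Legendre function `P_n^m` on `[-1, 1]`, with the sign `(-1)^m`. -/
def assocLegendre (n m : ℕ) (x : ℝ) : ℝ :=
  (-1) ^ m * Real.sqrt (1 - x ^ 2) ^ m * (Polynomial.derivative^[m] (legendre n)).eval x

/-- `P_{nm} = (-1)^m P_n^m`. -/
def signedLegendre (n m : ℕ) (x : ℝ) : ℝ := (-1) ^ m * assocLegendre n m x

/-- The restriction of `f` to the sphere `S(P, t)` with centre `(p, q, 0)` and radius `t`,
as a function on `S²`. -/
def restrict (f : Space → ℝ) (P : Plane) (t : ℝ) (ω : S2) : ℝ :=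
  f (embed P + t • (ω : Space))

/-- The coefficient `a_{0n}(p, q, t)`. -/
def a0 (f : Space → ℝ) (n : ℕ) (P : Plane) (t : ℝ) : ℝ :=
  (2 * (n : ℝ) + 1) / (4 * Real.pi) *
    ∫ ω, restrict f P t ω * (legendre n).eval (Real.cos (polar ω)) ∂surface

/-- The coefficient `a_{mn}(p, q, t)`, for `1 ≤ m ≤ n`. -/
def a (f : Space → ℝ) (m n : ℕ) (P : Plane) (t : ℝ) : ℝ :=
  (2 * (n : ℝ) + 1) / (2 * Real.pi) * (((n - m).factorial : ℝ) / ((n + m).factorial : ℝ)) *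
    ∫ ω, restrict f P t ω * signedLegendre n m (Real.cos (polar ω)) *
      Real.cos ((m : ℝ) * azimuth ω) ∂surface

/-- The coefficient `b_{mn}(p, q, t)`, for `1 ≤ m ≤ n`. -/
def b (f : Space → ℝ) (m n : ℕ) (P : Plane) (t : ℝ) : ℝ :=
  (2 * (n : ℝ) + 1) / (2 * Real.pi) * (((n - m).factorial : ℝ) / ((n + m).factorial : ℝ)) *
    ∫ ω, restrict f P t ω * signedLegendre n m (Real.cos (polar ω)) *
      Real.sin ((m : ℝ) * azimuth ω) ∂surface

/-- The partial derivative `∂g/∂p`. -/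
def partialP (g : Plane → ℝ) (P : Plane) : ℝ :=
  lineDeriv ℝ g P (EuclideanSpace.single 0 1)

/-- The partial derivative `∂g/∂q`. -/
def partialQ (g : Plane → ℝ) (P : Plane) : ℝ :=
  lineDeriv ℝ g P (EuclideanSpace.single 1 1)

/-- The iterated Laplacian `Δ^i (g(p, q, u))` with respect to `(p, q)`. -/
def lap (i : ℕ) (g : Plane → ℝ → ℝ) (P : Plane) (u : ℝ) : ℝ :=
  (Laplacian.laplacian^[i] (fun Q : Plane => g Q u)) P

/-- The bracketed term whose sum over `m` gives the top coefficient in `sStep`: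
`c j m` stands for `c_m(2k-1, 2j)` and `s j m` for `s_m(2(k-1), 2j)`. -/
def sTerm (k : ℕ) (c s : ℕ → ℕ → ℝ) (j m : ℕ) : ℝ :=
  c j m / ((k : ℝ) + (j : ℝ) - (m : ℝ)) -
    (2 * (k : ℝ) - 1) * ((k : ℝ) - 1) * (4 * (k : ℝ) - 1) * s j m /
      ((4 * (k : ℝ) - 3) * ((k : ℝ) + (j : ℝ) - (m : ℝ)))

/-- One step of the recurrence for `s`: from `c j m = c_m(2k-1, 2j)` and
`s j m = s_m(2(k-1), 2j)` to `s_m(2k, 2j)`, for `0 ≤ j ≤ k-1` and `1 ≤ m ≤ k+j`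
(and `0` otherwise). -/
def sStep (k : ℕ) (c s : ℕ → ℕ → ℝ) (j m : ℕ) : ℝ :=
  if k ≤ j ∨ m = 0 ∨ k + j < m then 0
  else if m < k + j then
    (4 * (k : ℝ) + 1) / (2 * (k : ℝ) * (2 * (k : ℝ) + 1)) *
      ((2 * (k : ℝ) - 1) * (2 * (k : ℝ) - 2) * s j m / (4 * (k : ℝ) - 3) + sTerm k c s j m)
  else
    (4 * (k : ℝ) + 1) / (2 * (k : ℝ) * (2 * (k : ℝ) + 1)) *
      ((if j = 0 then (8 * (k : ℝ) - 2) / 3 else (0 : ℝ))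
        - ∑ l ∈ Finset.Icc 1 (k + j - 1), sTerm k c s j l)

/-- The term whose sum over `m` gives the top coefficient in `cStep`:
`c i m` stands for `c_m(2k-1, 2i)` and `s j m` for `s_m(2k, 2j)`. -/
def cTerm (k : ℕ) (c s : ℕ → ℕ → ℝ) (i m : ℕ) : ℝ :=
  (4 * (k : ℝ) + 1) * c i m / ((8 * (k : ℝ) - 2) * ((k : ℝ) + (i : ℝ) - (m : ℝ))) +
    (if i = 0 then (0 : ℝ) else s (i - 1) m / (4 * ((k : ℝ) + (i : ℝ) - (m : ℝ))))

/-- One step of the recurrence for `c`: from `c i m = c_m(2k-1, 2i)` and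
`s j m = s_m(2k, 2j)` to `c_m(2k+1, 2i)`, for `0 ≤ i ≤ k` and `1 ≤ m ≤ k+i`
(and `0` otherwise). -/
def cStep (k : ℕ) (c s : ℕ → ℕ → ℝ) (i m : ℕ) : ℝ :=
  if k < i ∨ m = 0 ∨ k + i < m then 0
  else if m < k + i then
    (4 * (k : ℝ) + 3) * (c i m / (4 * (k : ℝ) - 1) - cTerm k c s i m)
  else
    (4 * (k : ℝ) + 3) *
      ((if i = 0 then -((4 * (k : ℝ) + 1) / 3) else (0 : ℝ))
        + ∑ l ∈ Finset.Icc 1 (k + i - 1), cTerm k c s i l)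

/-- The two coefficient arrays `(i, m) ↦ c_m(2k+1, 2i)` and `(j, m) ↦ s_m(2k, 2j)`. -/
def coeffs : ℕ → (ℕ → ℕ → ℝ) × (ℕ → ℕ → ℝ)
  | 0 => (fun _ _ => 0, fun _ _ => 0)
  | k + 1 =>
    let s := sStep (k + 1) (coeffs k).1 (coeffs k).2
    (cStep (k + 1) (coeffs k).1 s, s)

/-- `c k i m` is the coefficient `c_m(2k+1, 2i)`. -/
def c (k i m : ℕ) : ℝ := (coeffs k).1 i m

/-- `s k j m` is the coefficient `s_m(2k, 2j)`. -/
def s (k j m : ℕ) : ℝ := (coeffs k).2 j m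

/-- The integrand, on `0 ≤ u ≤ t`, of the representation of `a_{0(2k-1)}`. -/
def cIntegrand (f : Space → ℝ) (k : ℕ) (P : Plane) (t u : ℝ) : ℝ :=
  ∑ i ∈ Finset.range k, t ^ (2 * (i : ℤ) - 1) *
    ∑ m ∈ Finset.Icc 1 (k + i - 1),
      c (k - 1) i m * (u / t) ^ (2 * m + 1) * lap i (a0 f 1) P u

/-- The integrand, on `0 ≤ u ≤ t`, of the representation of
`∂_p a_{1(2k-2)} + ∂_q b_{1(2k-2)}`. -/
def sIntegrand (f : Space → ℝ) (k : ℕ) (P : Plane) (t u : ℝ) : ℝ :=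
  ∑ i ∈ Finset.Icc 1 (k - 1), t ^ (2 * (i - 1)) *
    ∑ m ∈ Finset.Icc 1 (k + i - 2),
      s (k - 1) (i - 1) m * (u / t) ^ (2 * m + 1) * lap i (a0 f 1) P u

end SphericalMeans

end

noncomputable section

namespace SphericalMeans

/-! Put `α k = a_{0(2k+1)} / (4k+3)`, and let `e k` be the divergence `∂_p a_{1(2k)} + ∂_q
b_{1(2k)}` multiplied by `2k(2k+1)/(4k+1)` for `k ≥ 1`, with `e 0 = 0`. With these normalizations
the claim is that both families are linear combinations of weighted radial means of `v i = Δ^i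
a_{01}`.

The two families are linked by a chain of first order equations in `t`: `t e_{k+1}' + (2k+3) e_{k+1}
= t e_k' - 2k e_k + 2(4k+3) t Δα_k`, `t α_{k+1}' + (2k+4) α_{k+1} = t α_k' - (2k+1) α_k - (t/2)
(4k+5)/((2k+2)(2k+3)) e_{k+1}`. They come from integration by parts on the sphere. The surface
measure is rotation invariant, so the fields `x_i ∂_j - x_j ∂_i` integrate to zero
(`integral_rotation_derivative`). A horizontal derivative of `f` can thus be traded for a radial
one, which is `d/dt` of the mean, plus a derivative of the weight (`euler_divergenceMean`,
`euler_zonalMean`). Classical Legendre identities turn the resulting weights into those of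
neighbouring coefficients (`euler_divergenceMean_legendre`, `euler_zonalMean_legendre`).

The homogeneous equation `t y' + N y = 0` has only the solutions `C t^(-N)` on `t > 0`, and
continuity at `0` forces `C = 0` (`eq_zero_of_euler`). So each equation determines the next
coefficient, and it suffices that the proposed sums solve the same equations. Since `t R_m' = v -
(2m+2) R_m` for the mean `R_m` of `v` with weight `r^(2m+1)`, this is a comparison of coefficients.
The terms in `R_m` give the recurrences below the top index, and the terms in `v(t)` fix the top
coefficient, whose factor in the first comparison vanishes. The induction on `k` is run for all
`Δ^i` at once (`radial_representation`). -/

/-! ### Legendre polynomial identities -/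

open Polynomial in
theorem derivative_X_sq_sub_one_pow_succ (n : ℕ) :
    derivative ((X ^ 2 - 1 : ℝ[X]) ^ (n + 1)) =
      C (2 * ((n : ℝ) + 1)) * ((X ^ 2 - 1) ^ n * X) := by
  rw [derivative_pow_succ]
  simp [map_ofNat]
  ring

-- One derivative of `(X ^ 2 - 1) ^ (n + 1)` is taken by hand, which leaves a multiple of `X * (X ^
-- 2 - 1) ^ n`; Leibniz' rule does the rest. The truncation of `n - 1` at `n = 0` is harmless
-- because of the factor `n`.
open Polynomial in
theorem legendre_succ (n : ℕ) :
    legendre (n + 1) = X * legendre n +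
      C (1 / (2 ^ n * (n.factorial : ℝ)) * n) * derivative^[n - 1] ((X ^ 2 - 1) ^ n) := by
  have hκ : 1 / (2 ^ (n + 1) * ((n + 1).factorial : ℝ)) * (2 * ((n : ℝ) + 1)) =
      1 / (2 ^ n * (n.factorial : ℝ)) := by
    rw [Nat.factorial_succ]; push_cast; field_simp; ring
  rw [legendre, Function.iterate_succ_apply, derivative_X_sq_sub_one_pow_succ,
    iterate_derivative_C_mul, ← mul_assoc, ← C_mul, hκ, iterate_derivative_mul_X, legendre,
    C_mul, nsmul_eq_mul]
  simp only [map_natCast]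
  ring

open Polynomial in
theorem derivative_legendre_succ (n : ℕ) :
    derivative (legendre (n + 1)) =
      X * derivative (legendre n) + C ((n : ℝ) + 1) * legendre n := by
  rw [legendre_succ, derivative_add, derivative_mul, derivative_C_mul]
  rcases n with _ | n
  · simp [add_comm]
  · rw [Nat.add_sub_cancel, ← Function.iterate_succ_apply' (⇑derivative) n]
    simp only [legendre, C_mul, C_add, derivative_X, map_natCast, C_1]
    push_cast
    ring

open Polynomial in
theorem derivative_legendre_add_two (n : ℕ) :
    derivative (legendre (n + 2)) =
      C (2 * (n : ℝ) + 3) * legendre (n + 1) + derivative (legendre n) := by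
  have h2 : derivative (derivative ((X ^ 2 - 1 : ℝ[X]) ^ (n + 2))) =
      C (2 * ((n : ℝ) + 2)) * (C (2 * (n : ℝ) + 3) * (X ^ 2 - 1) ^ (n + 1) +
        C (2 * ((n : ℝ) + 1)) * (X ^ 2 - 1) ^ n) := by
    rw [derivative_X_sq_sub_one_pow_succ, derivative_C_mul, derivative_mul,
      derivative_X_sq_sub_one_pow_succ]
    simp only [C_mul, C_add, derivative_X, map_natCast, C_1, map_ofNat]
    push_cast
    ring
  have hκ : 1 / (2 ^ (n + 2) * ((n + 2).factorial : ℝ)) * (2 * ((n : ℝ) + 2)) =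
      1 / (2 ^ (n + 1) * ((n + 1).factorial : ℝ)) := by
    rw [Nat.factorial_succ (n + 1)]; push_cast; field_simp; ring
  have hκ' : 1 / (2 ^ (n + 1) * ((n + 1).factorial : ℝ)) * (2 * ((n : ℝ) + 1)) =
      1 / (2 ^ n * (n.factorial : ℝ)) := by
    rw [Nat.factorial_succ]; push_cast; field_simp; ring
  rw [legendre, derivative_C_mul, ← Function.iterate_succ_apply' (⇑derivative),
    Function.iterate_succ_apply, Function.iterate_succ_apply, h2, iterate_derivative_C_mul,
    ← mul_assoc, ← C_mul, hκ, iterate_map_add, iterate_derivative_C_mul,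
    iterate_derivative_C_mul, legendre, mul_add, ← mul_assoc _ (C (2 * ((n : ℝ) + 1))), ← C_mul,
    hκ', legendre, derivative_C_mul, ← Function.iterate_succ_apply' (⇑derivative)]
  ring

-- This is Legendre's equation `((X ^ 2 - 1) P_n')' = n (n + 1) P_n` integrated once. It follows by
-- differentiating `(X ^ 2 - 1) u' = 2 n X u`, where `u = (X ^ 2 - 1) ^ n`, exactly `n` times.
open Polynomial in
theorem X_sq_sub_one_mul_iterate_derivative (n : ℕ) :
    (X ^ 2 - 1) * derivative^[n + 1] ((X ^ 2 - 1 : ℝ[X]) ^ n) =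
      C ((n : ℝ) * (n + 1)) * derivative^[n - 1] ((X ^ 2 - 1) ^ n) := by
  rcases n with _ | n
  · simp
  have h : derivative ((X ^ 2 - 1 : ℝ[X]) ^ (n + 1)) * X * X -
      derivative ((X ^ 2 - 1 : ℝ[X]) ^ (n + 1)) =
      C (2 * ((n : ℝ) + 1)) * ((X ^ 2 - 1) ^ (n + 1) * X) := by
    rw [derivative_X_sq_sub_one_pow_succ]; ring
  have h' := congrArg (derivative^[n + 1]) h
  rw [iterate_derivative_sub, iterate_derivative_mul_X, iterate_derivative_mul_X,
    iterate_derivative_C_mul, iterate_derivative_mul_X, Nat.add_sub_cancel,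
    iterate_derivative_mul_X] at h'
  rw [Nat.add_sub_cancel, Function.iterate_succ_apply]
  generalize hu : (X ^ 2 - 1 : ℝ[X]) ^ (n + 1) = u at *
  have h1 : derivative^[n] (derivative u) = derivative^[n + 1] u := rfl
  -- The factor `n` absorbs the truncated subtraction when `n = 0`.
  have h0 : (n : ℝ[X]) * derivative^[n - 1] (derivative u) = n * derivative^[n] u := by
    rcases n with _ | n
    · simp
    · rfl
  simp only [nsmul_eq_mul, C_mul, C_add, map_natCast, C_1, map_ofNat, h1] at h' ⊢
  push_cast at h' ⊢
  linear_combination h' - ((n : ℝ[X]) + 1) * h0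

open Polynomial in
theorem X_sq_sub_one_mul_derivative_legendre (n : ℕ) :
    (X ^ 2 - 1) * derivative (legendre n) =
      C ((n : ℝ) + 1) * (legendre (n + 1) - X * legendre n) := by
  rw [legendre_succ, add_sub_cancel_left, legendre, derivative_C_mul,
    ← Function.iterate_succ_apply' (⇑derivative), mul_left_comm,
    X_sq_sub_one_mul_iterate_derivative]
  simp only [C_mul, C_add, map_natCast, C_1]
  ring

open Polynomial in
theorem X_sq_sub_one_mul_derivative_legendre_succ (n : ℕ) :
    C (2 * (n : ℝ) + 3) * ((X ^ 2 - 1) * derivative (legendre (n + 1))) =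
      C (((n : ℝ) + 1) * (n + 2)) * (legendre (n + 2) - legendre n) := by
  have h1 := X_sq_sub_one_mul_derivative_legendre (n + 1)
  have h2 := X_sq_sub_one_mul_derivative_legendre n
  have h3 := derivative_legendre_succ n
  simp only [C_mul, C_add, map_natCast, C_1, map_ofNat] at h1 h2 h3 ⊢
  push_cast at h1
  linear_combination ((n : ℝ[X]) + 1) * h1 + (n + 2 : ℝ[X]) * ((X ^ 2 - 1) * h3 + X * h2)

theorem legendre_zero : legendre 0 = 1 := by simp [legendre]

/-! ### The coefficient arrays -/

theorem c_eq_zero {k i m : ℕ} (h : k < i ∨ m = 0 ∨ k + i < m) : c k i m = 0 := by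
  rcases k with _ | k
  · rfl
  · exact if_pos h

theorem s_eq_zero {k j m : ℕ} (h : k ≤ j ∨ m = 0 ∨ k + j < m) : s k j m = 0 := by
  rcases k with _ | k
  · rfl
  · exact if_pos h

theorem s_succ (k j m : ℕ) : s (k + 1) j m = sStep (k + 1) (c k) (s k) j m := rfl

theorem c_succ (k j m : ℕ) : c (k + 1) j m = cStep (k + 1) (c k) (s (k + 1)) j m := rfl

/-- The coefficients `c_m(2k+1, 2i) / (4k+3)`. -/
def cNormalized (k i m : ℕ) : ℝ := c k i m / (4 * k + 3)

/-- The coefficients `2k (2k+1) s_m(2k, 2j) / (4k+1)`. -/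
def sNormalized (k j m : ℕ) : ℝ := 2 * k * (2 * k + 1) / (4 * k + 1) * s k j m

theorem sNormalized_succ_of_lt {k j m : ℕ} (hj : j ≤ k) (hm : 1 ≤ m) (hmk : m < k + 1 + j) :
    sNormalized (k + 1) j m = sNormalized k j m + sTerm (k + 1) (c k) (s k) j m := by
  rw [sNormalized, s_succ, sStep, if_neg (by omega), if_pos hmk, sNormalized]
  push_cast
  have : (4 * ((k : ℝ) + 1) - 3) ≠ 0 := by nlinarith [(Nat.cast_nonneg k : (0 : ℝ) ≤ k)]
  have h1 : (4 * ((k : ℝ) + 1) - 3) = 4 * k + 1 := by ring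
  rw [h1] at this ⊢
  field_simp
  ring

theorem sNormalized_succ_top {k j : ℕ} (hj : j ≤ k) :
    sNormalized (k + 1) j (k + 1 + j) = (if j = 0 then (8 * (k : ℝ) + 6) / 3 else 0)
        - ∑ l ∈ Finset.Icc 1 (k + j), sTerm (k + 1) (c k) (s k) j l := by
  rw [sNormalized, s_succ, sStep, if_neg (by omega), if_neg (by omega),
    show k + 1 + j - 1 = k + j by omega]
  push_cast
  have h2 : (8 * ((k : ℝ) + 1) - 2) = 8 * k + 6 := by ring
  rw [h2, ← mul_assoc]
  have h3 : 2 * ((k : ℝ) + 1) * (2 * (k + 1) + 1) / (4 * (k + 1) + 1) *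
      ((4 * (k + 1) + 1) / (2 * (k + 1) * (2 * (k + 1) + 1))) = 1 := by field_simp
  rw [h3, one_mul]

theorem cNormalized_succ_of_lt {k i m : ℕ} (hi : i ≤ k + 1) (hm : 1 ≤ m) (hmk : m < k + 1 + i) :
    cNormalized (k + 1) i m = cNormalized k i m - cTerm (k + 1) (c k) (s (k + 1)) i m := by
  rw [cNormalized, c_succ, cStep, if_neg (by omega), if_pos hmk, cNormalized]
  push_cast
  rw [show 4 * ((k : ℝ) + 1) - 1 = 4 * k + 3 by ring]
  field_simp

theorem cNormalized_succ_top {k i : ℕ} (hi : i ≤ k + 1) :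
    cNormalized (k + 1) i (k + 1 + i) = (if i = 0 then -((4 * (k : ℝ) + 5) / 3) else 0)
        + ∑ l ∈ Finset.Icc 1 (k + i), cTerm (k + 1) (c k) (s (k + 1)) i l := by
  rw [cNormalized, c_succ, cStep, if_neg (by omega), if_neg (by omega),
    show k + 1 + i - 1 = k + i by omega]
  push_cast
  rw [mul_div_cancel_left₀ _ (by positivity), show 4 * ((k : ℝ) + 1) + 1 = 4 * k + 5 by ring]

/-- Cleared of denominators, the recurrence also covers the top index `m = k + 1 + j`: the left
factor vanishes there, and the old coefficients are outside their range. This is the comparison of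
coefficients of the radial means. -/
theorem sNormalized_recurrence {k j m : ℕ} (hj : j ≤ k) (hm : 1 ≤ m) (hmk : m ≤ k + 1 + j) :
    2 * ((k : ℝ) + 1 + j - m) * sNormalized (k + 1) j m =
      (2 * (j : ℝ) - 2 * m - 2 * k - 1) * sNormalized k j m + 2 * c k j m := by
  rcases hmk.lt_or_eq with h | h
  · rw [sNormalized_succ_of_lt hj hm h, sTerm, sNormalized]
    have h0 : (k : ℝ) + 1 + j - m ≠ 0 := by
      have : (m : ℝ) < k + 1 + j := by exact_mod_cast h
      linarith
    have h1 : (4 * (k : ℝ) + 1) ≠ 0 := by positivity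
    push_cast
    rw [show 4 * ((k : ℝ) + 1) - 3 = 4 * k + 1 by ring]
    field_simp
    ring
  · rw [c_eq_zero (by omega), sNormalized, sNormalized, s_eq_zero (k := k) (by omega), h]
    push_cast
    ring

/-- The top coefficient is defined precisely to give this sum, which is the comparison of
coefficients of the boundary values `v(t)`. -/
theorem sum_sNormalized_succ {k j : ℕ} (hj : j ≤ k) :
    ∑ m ∈ Finset.Icc 1 (k + 1 + j), sNormalized (k + 1) j m =
      ∑ m ∈ Finset.Icc 1 (k + 1 + j), sNormalized k j m +
        (if j = 0 then (8 * (k : ℝ) + 6) / 3 else 0) := by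
  rw [show k + 1 + j = k + j + 1 by omega, Finset.sum_Icc_succ_top (by omega),
    Finset.sum_Icc_succ_top (by omega), show k + j + 1 = k + 1 + j by omega,
    sNormalized_succ_top hj, Finset.sum_congr rfl fun m hm => sNormalized_succ_of_lt hj
      (Finset.mem_Icc.1 hm).1 (by have := (Finset.mem_Icc.1 hm).2; omega),
    Finset.sum_add_distrib, sNormalized, s_eq_zero (k := k) (m := k + 1 + j) (by omega)]
  ring

theorem cNormalized_recurrence {k i m : ℕ} (hi : i ≤ k + 1) (hm : 1 ≤ m) (hmk : m ≤ k + 1 + i) :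
    2 * ((k : ℝ) + 1 + i - m) * cNormalized (k + 1) i m =
      (2 * (i : ℝ) - 2 * m - 2 * k - 3) * cNormalized k i m -
        (if i = 0 then 0 else s (k + 1) (i - 1) m) / 2 := by
  rcases hmk.lt_or_eq with h | h
  · rw [cNormalized_succ_of_lt hi hm h, cTerm, cNormalized]
    have h0 : (k : ℝ) + 1 + i - m ≠ 0 := by
      have : (m : ℝ) < k + 1 + i := by exact_mod_cast h
      linarith
    have h1 : (4 * (k : ℝ) + 3) ≠ 0 := by positivity
    push_cast
    rw [show 8 * ((k : ℝ) + 1) - 2 = 2 * (4 * k + 3) by ring]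
    split_ifs <;> field_simp <;> ring
  · rw [cNormalized, cNormalized, c_eq_zero (k := k) (by omega), h]
    split_ifs with hi0
    · push_cast
      ring
    · rw [s_eq_zero (by omega)]
      push_cast
      ring

theorem sum_cNormalized_succ {k i : ℕ} (hi : i ≤ k + 1) :
    ∑ m ∈ Finset.Icc 1 (k + 1 + i), cNormalized (k + 1) i m =
      ∑ m ∈ Finset.Icc 1 (k + 1 + i), cNormalized k i m +
        (if i = 0 then -((4 * (k : ℝ) + 5) / 3) else 0) := by
  rw [show k + 1 + i = k + i + 1 by omega, Finset.sum_Icc_succ_top (by omega),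
    Finset.sum_Icc_succ_top (by omega), show k + i + 1 = k + 1 + i by omega,
    cNormalized_succ_top hi, Finset.sum_congr rfl fun m hm => cNormalized_succ_of_lt hi
      (Finset.mem_Icc.1 hm).1 (by have := (Finset.mem_Icc.1 hm).2; omega),
    Finset.sum_sub_distrib, cNormalized, c_eq_zero (k := k) (m := k + 1 + i) (by omega)]
  ring

/-! ### Weighted radial means -/

/-- The weighted mean `∫₀¹ r^(2m+1) v(t r) dr`. -/
def radialMean (m : ℕ) (v : ℝ → ℝ) (t : ℝ) : ℝ := ∫ r in (0 : ℝ)..1, r ^ (2 * m + 1) * v (t * r)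

theorem continuous_radialMean (m : ℕ) {v : ℝ → ℝ} (hv : Continuous v) :
    Continuous (radialMean m v) := by
  refine intervalIntegral.continuous_parametric_intervalIntegral_of_continuous' ?_ 0 1
  fun_prop

theorem integral_pow_mul_eq_radialMean (m : ℕ) (v : ℝ → ℝ) {t : ℝ} (ht : t ≠ 0) :
    ∫ u in (0 : ℝ)..t, (u / t) ^ (2 * m + 1) * v u = t * radialMean m v t := by
  have h := intervalIntegral.integral_comp_mul_left (a := 0) (b := 1)
    (fun u => (u / t) ^ (2 * m + 1) * v u) ht
  rw [mul_zero, mul_one] at h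
  rw [radialMean]
  have h2 : ∀ r : ℝ, (t * r / t) = r := fun r => by field_simp
  simp only [h2] at h
  rw [h, smul_eq_mul, mul_inv_cancel_left₀ ht]

theorem radialMean_eq_div (m : ℕ) (v : ℝ → ℝ) {t : ℝ} (ht : t ≠ 0) :
    radialMean m v t = (∫ u in (0 : ℝ)..t, u ^ (2 * m + 1) * v u) / t ^ (2 * m + 2) := by
  have h := integral_pow_mul_eq_radialMean m v ht
  have h2 : ∀ u : ℝ, (u / t) ^ (2 * m + 1) * v u = (t ^ (2 * m + 1))⁻¹ * (u ^ (2 * m + 1) * v u) :=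
    fun u => by rw [div_pow]; ring
  simp only [h2, intervalIntegral.integral_const_mul] at h
  field_simp at h ⊢
  rw [pow_succ' t (2 * m + 1), mul_comm (radialMean m v t), h]
  ring

/-- After the substitution `u = t r` the mean is a quotient of an integral with variable endpoint by
a power of `t`. The resulting equation `t R' = v - (2m+2) R` is what makes radial means suitable for
Euler equations. -/
theorem hasDerivAt_radialMean (m : ℕ) {v : ℝ → ℝ} (hv : Continuous v) {t : ℝ} (ht : 0 < t) :
    HasDerivAt (radialMean m v) ((v t - (2 * m + 2) * radialMean m v t) / t) t := by
  have hcont : Continuous fun u : ℝ => u ^ (2 * m + 1) * v u := by fun_prop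
  have h1 : HasDerivAt (fun t => ∫ u in (0 : ℝ)..t, u ^ (2 * m + 1) * v u)
      (t ^ (2 * m + 1) * v t) t :=
    intervalIntegral.integral_hasDerivAt_right (hcont.intervalIntegrable _ _)
      (hcont.stronglyMeasurableAtFilter _ _) hcont.continuousAt
  have h2 := h1.div (hasDerivAt_pow (2 * m + 2) t) (by positivity)
  have h3 : radialMean m v =ᶠ[nhds t] fun t =>
      (∫ u in (0 : ℝ)..t, u ^ (2 * m + 1) * v u) / t ^ (2 * m + 2) := by
    filter_upwards [eventually_ne_nhds ht.ne'] with x hx using radialMean_eq_div m v hx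
  refine (h2.congr_of_eventuallyEq h3).congr_deriv ?_
  rw [radialMean_eq_div m v ht.ne']
  generalize (∫ u in (0 : ℝ)..t, u ^ (2 * m + 1) * v u) = I
  rw [show 2 * m + 2 - 1 = 2 * m + 1 by omega, pow_succ t (2 * m + 1)]
  push_cast
  field_simp

/-! ### Euler equations -/

/-- The equation says that `t ^ N * y t` has zero derivative, hence is constant on `t > 0`; since
`y` is continuous at `0` and `N > 0`, the constant is its limit `0`. -/
theorem eq_zero_of_euler {y : ℝ → ℝ} {N : ℕ} (hN : N ≠ 0) (hy : ContinuousAt y 0)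
    (hd : ∀ t, 0 < t → DifferentiableAt ℝ y t)
    (h : ∀ t, 0 < t → t * deriv y t + N * y t = 0) {t : ℝ} (ht : 0 < t) : y t = 0 := by
  have hz : ∀ r, 0 < r → HasDerivAt (fun r => r ^ N * y r) 0 r := fun r hr => by
    refine ((hasDerivAt_pow N r).mul (hd r hr).hasDerivAt).congr_deriv ?_
    obtain ⟨n, rfl⟩ := Nat.exists_eq_succ_of_ne_zero hN
    have := h r hr
    simp only [Nat.succ_eq_add_one, Nat.add_sub_cancel]
    linear_combination r ^ n * this
  have hconst : ∀ r, 0 < r → r ^ N * y r = t ^ N * y t := fun r hr =>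
    isOpen_Ioi.is_const_of_deriv_eq_zero (convex_Ioi (0 : ℝ)).isPreconnected
      (fun x hx => (hz x hx).differentiableAt.differentiableWithinAt)
      (fun x hx => (hz x hx).deriv) hr ht
  have hlim : Filter.Tendsto (fun r => r ^ N * y r) (nhdsWithin 0 (Set.Ioi 0)) (nhds 0) := by
    have : ContinuousAt (fun r => r ^ N * y r) 0 := (continuousAt_id.pow N).mul hy
    have h0 := this.tendsto.mono_left (nhdsWithin_le_nhds (s := Set.Ioi 0))
    simpa [hN] using h0
  have hlim' : Filter.Tendsto (fun r => r ^ N * y r) (nhdsWithin 0 (Set.Ioi 0))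
      (nhds (t ^ N * y t)) :=
    tendsto_const_nhds.congr' (by
      filter_upwards [self_mem_nhdsWithin] with r hr using (hconst r hr).symm)
  have := tendsto_nhds_unique hlim' hlim
  exact (mul_eq_zero.1 this).resolve_left (by positivity)

/-- The double sum of `κ l m t^(2l) ∫₀¹ r^(2m+1) v_{i+l}(t r) dr` over `l < n` and
`1 ≤ m ≤ q + l`. -/
def radialSum (κ : ℕ → ℕ → ℝ) (n q : ℕ) (v : ℕ → ℝ → ℝ) (i : ℕ) (t : ℝ) : ℝ :=
  ∑ l ∈ Finset.range n, ∑ m ∈ Finset.Icc 1 (q + l),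
    κ l m * t ^ (2 * l) * radialMean m (v (i + l)) t

theorem continuous_radialSum (κ : ℕ → ℕ → ℝ) (n q : ℕ) {v : ℕ → ℝ → ℝ}
    (hv : ∀ i, Continuous (v i)) (i : ℕ) : Continuous (radialSum κ n q v i) := by
  refine continuous_finsetSum _ fun l _ => continuous_finsetSum _ fun m _ => ?_
  exact (continuous_const.mul (continuous_pow _)).mul (continuous_radialMean m (hv _))

theorem hasDerivAt_radialSum (κ : ℕ → ℕ → ℝ) (n q : ℕ) {v : ℕ → ℝ → ℝ}
    (hv : ∀ i, Continuous (v i)) (i : ℕ) {t : ℝ} (ht : 0 < t) :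
    HasDerivAt (radialSum κ n q v i)
      ((∑ l ∈ Finset.range n, ∑ m ∈ Finset.Icc 1 (q + l), κ l m * t ^ (2 * l) *
        (v (i + l) t + (2 * l - 2 * m - 2) * radialMean m (v (i + l)) t)) / t) t := by
  rw [Finset.sum_div]
  simp only [Finset.sum_div]
  refine HasDerivAt.fun_sum fun l _ => HasDerivAt.fun_sum fun m _ => ?_
  refine (((hasDerivAt_pow (2 * l) t).const_mul (κ l m)).mul
    (hasDerivAt_radialMean m (hv _) ht)).congr_deriv ?_
  rcases l with _ | l
  · simp; ring
  · rw [show 2 * (l + 1) - 1 = 2 * l + 1 by omega, show 2 * (l + 1) = 2 * l + 1 + 1 by ring]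
    push_cast
    field_simp
    ring

theorem radialSum_extend {κ : ℕ → ℕ → ℝ} {n q n' q' : ℕ} (hn : n ≤ n') (hq : q ≤ q')
    (h : ∀ l m, n ≤ l ∨ q + l < m → κ l m = 0) (v : ℕ → ℝ → ℝ) (i : ℕ) :
    radialSum κ n q v i = radialSum κ n' q' v i := by
  funext t
  rw [radialSum, radialSum]
  have h1 : ∀ l, ∑ m ∈ Finset.Icc 1 (q + l), κ l m * t ^ (2 * l) * radialMean m (v (i + l)) t =
      ∑ m ∈ Finset.Icc 1 (q' + l), κ l m * t ^ (2 * l) * radialMean m (v (i + l)) t := fun l => by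
    refine Finset.sum_subset (Finset.Icc_subset_Icc le_rfl (by omega)) fun m hm hm' => ?_
    simp only [Finset.mem_Icc] at hm hm'
    rw [h l m (by omega), zero_mul, zero_mul]
  rw [Finset.sum_congr rfl fun l _ => h1 l]
  refine Finset.sum_subset (Finset.range_mono hn) fun l _ hl => Finset.sum_eq_zero fun m _ => ?_
  rw [h l m (Or.inl (by simpa using hl)), zero_mul, zero_mul]

/-! ### Comparison of coefficients -/

/-- Here `w` stands for a boundary value, common to all `m`, and `W m` for the `m`-th radial mean.
Coefficients of `w` need to match only in total, those of `W m` one by one. -/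
theorem sum_transfer {ι : Type*} (M : Finset ι) {a b x y d F G H W : ι → ℝ} {δ w : ℝ}
    (hsum : ∑ m ∈ M, a m = ∑ m ∈ M, b m + δ) (hrec : ∀ m ∈ M, x m * a m = y m * b m + d m)
    (hF : ∀ m, F m = a m * w + x m * a m * W m)
    (hG : ∀ m, G m + H m = b m * w + (y m * b m + d m) * W m) :
    ∑ m ∈ M, F m = ∑ m ∈ M, G m + (δ * w + ∑ m ∈ M, H m) := by
  rw [add_left_comm, ← Finset.sum_add_distrib, Finset.sum_congr rfl fun m _ => hF m,
    Finset.sum_congr rfl fun m _ => hG m, Finset.sum_add_distrib, Finset.sum_add_distrib,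
    ← Finset.sum_mul, ← Finset.sum_mul, hsum,
    Finset.sum_congr rfl fun m hm => congrArg (· * W m) (hrec m hm)]
  ring

/-- The Euler equation for `e` evaluated on the proposed sums and divided by `t`. The prefactor `t`
of `e` shifts the constants `2k + 3` and `-2k` to `2k + 4` and `1 - 2k`. -/
theorem radialSum_sNormalized_step (k i : ℕ) (v : ℕ → ℝ → ℝ) (t : ℝ) :
    (∑ l ∈ Finset.range (k + 1), ∑ m ∈ Finset.Icc 1 (k + 1 + l),
      sNormalized (k + 1) l m * t ^ (2 * l) *
        (v (i + l) t + (2 * l - 2 * m - 2) * radialMean m (v (i + l)) t)) +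
      (2 * k + 4) * radialSum (sNormalized (k + 1)) (k + 1) (k + 1) v i t =
    (∑ l ∈ Finset.range (k + 1), ∑ m ∈ Finset.Icc 1 (k + 1 + l),
      sNormalized k l m * t ^ (2 * l) *
        (v (i + l) t + (2 * l - 2 * m - 2) * radialMean m (v (i + l)) t)) +
      (1 - 2 * k) * radialSum (sNormalized k) (k + 1) (k + 1) v i t +
      2 * (4 * k + 3) * (v i t / 3 + radialSum (cNormalized k) (k + 1) (k + 1) v i t) := by
  have hδ : 2 * (4 * (k : ℝ) + 3) * (v i t / 3) = ∑ l ∈ Finset.range (k + 1),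
      (if l = 0 then (8 * (k : ℝ) + 6) / 3 else 0) * (t ^ (2 * l) * v (i + l) t) := by
    rw [Finset.sum_eq_single 0 (fun l _ hl => by simp [hl]) (by simp)]
    simp
    ring
  rw [mul_add, hδ]
  simp only [radialSum, Finset.mul_sum, ← Finset.sum_add_distrib]
  simp only [Finset.sum_add_distrib (s := Finset.range (k + 1))]
  simp only [← Finset.sum_add_distrib (s := Finset.range (k + 1))]
  refine Finset.sum_congr rfl fun l hl => ?_
  have hl' : l ≤ k := by simpa [Nat.lt_succ_iff] using hl
  refine sum_transfer (Finset.Icc 1 (k + 1 + l)) (sum_sNormalized_succ hl')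
    (fun m hm => sNormalized_recurrence hl' (Finset.mem_Icc.1 hm).1 (Finset.mem_Icc.1 hm).2)
    (W := fun m => t ^ (2 * l) * radialMean m (v (i + l)) t) (fun m => ?_) (fun m => ?_)
  · ring
  · rw [cNormalized]
    have : (4 * (k : ℝ) + 3) ≠ 0 := by positivity
    field_simp
    ring

/-- Reindexing by `l ↦ l + 1`: the sum for `e` starts at `Δ^(i+1)` and carries an extra `t ^ 2`, so
it becomes a sum starting at `Δ^i` with no term `l = 0`. This accounts for `s_m(2k, 2(i-1))` in the
recurrence for `c`. -/
theorem radialSum_sNormalized_shift (k i : ℕ) (v : ℕ → ℝ → ℝ) (t : ℝ) :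
    t ^ 2 * ((4 * k + 5) / ((2 * k + 2) * (2 * k + 3))) *
        radialSum (sNormalized (k + 1)) (k + 1) (k + 1) v (i + 1) t =
      radialSum (fun l m => if l = 0 then 0 else s (k + 1) (l - 1) m) (k + 2) (k + 1) v i t := by
  rw [radialSum, radialSum, Finset.sum_range_succ' _ (k + 1)]
  simp only [if_true, zero_mul, Finset.sum_const_zero, add_zero, Finset.mul_sum, Nat.add_sub_cancel,
    Nat.add_eq_zero_iff, one_ne_zero, and_false, if_false]
  refine Finset.sum_congr rfl fun l _ => ?_
  rw [← Nat.add_assoc (k + 1) l 1, Finset.sum_Icc_succ_top (by omega),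
    s_eq_zero (m := k + 1 + l + 1) (by omega), zero_mul, zero_mul, add_zero]
  refine Finset.sum_congr rfl fun m _ => ?_
  rw [sNormalized, show i + 1 + l = i + (l + 1) by omega]
  push_cast
  field_simp
  ring

/-- The Euler equation for `α` evaluated on the proposed sums. The boundary term `-(4k+5)/3 * v` is
what the summand `v / 3` of `α` leaves behind: `-(2k+1)/3 - (2k+4)/3`. -/
theorem radialSum_cNormalized_step (k i : ℕ) (v : ℕ → ℝ → ℝ) (t : ℝ) :
    (∑ l ∈ Finset.range (k + 2), ∑ m ∈ Finset.Icc 1 (k + 1 + l),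
      cNormalized (k + 1) l m * t ^ (2 * l) *
        (v (i + l) t + (2 * l - 2 * m - 2) * radialMean m (v (i + l)) t)) +
      (2 * k + 4) * radialSum (cNormalized (k + 1)) (k + 2) (k + 1) v i t =
    (∑ l ∈ Finset.range (k + 2), ∑ m ∈ Finset.Icc 1 (k + 1 + l),
      cNormalized k l m * t ^ (2 * l) *
        (v (i + l) t + (2 * l - 2 * m - 2) * radialMean m (v (i + l)) t)) +
      (-(2 * k + 1)) * radialSum (cNormalized k) (k + 2) (k + 1) v i t +
      (-((4 * k + 5) / 3 * v i t) + (-(1 / 2)) * radialSum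
        (fun l m => if l = 0 then 0 else s (k + 1) (l - 1) m) (k + 2) (k + 1) v i t) := by
  have hδ : -((4 * (k : ℝ) + 5) / 3 * v i t) = ∑ l ∈ Finset.range (k + 2),
      (if l = 0 then -((4 * (k : ℝ) + 5) / 3) else 0) * (t ^ (2 * l) * v (i + l) t) := by
    rw [Finset.sum_eq_single 0 (fun l _ hl => by simp [hl]) (by simp)]
    simp
  rw [hδ]
  simp only [radialSum, Finset.mul_sum, ← Finset.sum_add_distrib]
  simp only [Finset.sum_add_distrib (s := Finset.range (k + 2))]
  simp only [← Finset.sum_add_distrib (s := Finset.range (k + 2))]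
  refine Finset.sum_congr rfl fun l hl => ?_
  have hl' : l ≤ k + 1 := by simpa [Nat.lt_succ_iff] using hl
  refine sum_transfer (Finset.Icc 1 (k + 1 + l)) (sum_cNormalized_succ hl')
    (fun m hm => (cNormalized_recurrence hl' (Finset.mem_Icc.1 hm).1 (Finset.mem_Icc.1 hm).2).trans
      (sub_eq_add_neg _ _))
    (W := fun m => t ^ (2 * l) * radialMean m (v (i + l)) t) (fun m => ?_) (fun m => ?_)
  · ring
  · ring

theorem cNormalized_eq_zero {k i m : ℕ} (h : k < i ∨ m = 0 ∨ k + i < m) :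
    cNormalized k i m = 0 := by
  rw [cNormalized, c_eq_zero h, zero_div]

theorem sNormalized_eq_zero {k i m : ℕ} (h : k ≤ i ∨ m = 0 ∨ k + i < m) :
    sNormalized k i m = 0 := by
  rw [sNormalized, s_eq_zero h, mul_zero]

/-! ### Solving the chain of Euler equations -/

variable {v : ℕ → ℝ → ℝ} {α e : ℕ → ℕ → ℝ → ℝ}

theorem eq_mul_radialSum_succ {k : ℕ} (hv : ∀ i, Differentiable ℝ (v i))
    (he : ∀ i, Differentiable ℝ (e (k + 1) i))
    (hE : ∀ i t, 0 < t → t * deriv (e (k + 1) i) t + (2 * k + 3) * e (k + 1) i t =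
      t * deriv (e k i) t - 2 * k * e k i t + 2 * (4 * k + 3) * t * α k (i + 1) t)
    (hα : ∀ i t, 0 < t → α k i t = v i t / 3 + radialSum (cNormalized k) (k + 1) k v i t)
    (hek : ∀ i t, 0 < t → e k i t = t * radialSum (sNormalized k) k k v (i + 1) t)
    (i : ℕ) (t : ℝ) (ht : 0 < t) :
    e (k + 1) i t = t * radialSum (sNormalized (k + 1)) (k + 1) (k + 1) v (i + 1) t := by
  have hc : ∀ i, Continuous (v i) := fun i => (hv i).continuous
  simp only [radialSum_extend (κ := sNormalized k) (n := k) (q := k) (n' := k + 1) (q' := k + 1) (by omega) (by omega)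
    fun l m h => sNormalized_eq_zero (by omega)] at hek
  simp only [radialSum_extend (κ := cNormalized k) (n := k + 1) (q := k) (n' := k + 1) (q' := k + 1) (by omega) (by omega)
    fun l m h => cNormalized_eq_zero (by omega)] at hα
  have hS := fun (κ : ℕ → ℕ → ℝ) (t : ℝ) (ht : 0 < t) => (hasDerivAt_id t).mul
    (hasDerivAt_radialSum κ (k + 1) (k + 1) hc (i + 1) ht)
  refine sub_eq_zero.1 (eq_zero_of_euler (N := 2 * k + 3) (y := fun t => e (k + 1) i t -
    t * radialSum (sNormalized (k + 1)) (k + 1) (k + 1) v (i + 1) t) (by omega) ?_ ?_ ?_ ht)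
  · exact ((he i).continuous.sub (continuous_id.mul (continuous_radialSum _ _ _ hc _))).continuousAt
  · exact fun t ht => (he i t).sub (hS _ t ht).differentiableAt
  · intro t ht
    -- The formula for `e k i` is known only for positive arguments, which suffices for the
    -- derivative at `t > 0`.
    have hd : deriv (e k i) t = _ :=
      ((hS (sNormalized k) t ht).congr_of_eventuallyEq (by
        filter_upwards [eventually_gt_nhds ht] with r hr using hek i r hr)).deriv
    have hd' := ((he i t).hasDerivAt.sub (hS (sNormalized (k + 1)) t ht)).deriv
    have h1 := hE i t ht
    have h2 := radialSum_sNormalized_step k (i + 1) v t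
    rw [hd, hek i t ht, hα (i + 1) t ht] at h1
    refine (congrArg (fun z => t * z + _) hd').trans ?_
    simp only [id, one_mul, mul_div_cancel₀ _ ht.ne'] at h1 ⊢
    push_cast
    linear_combination h1 - t * h2

theorem eq_add_radialSum_succ {k : ℕ} (hv : ∀ i, Differentiable ℝ (v i))
    (hα : ∀ i, Differentiable ℝ (α (k + 1) i))
    (hA : ∀ i t, 0 < t → t * deriv (α (k + 1) i) t + (2 * k + 4) * α (k + 1) i t =
      t * deriv (α k i) t - (2 * k + 1) * α k i t -
        t / 2 * ((4 * k + 5) / ((2 * k + 2) * (2 * k + 3)) * e (k + 1) i t))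
    (hαk : ∀ i t, 0 < t → α k i t = v i t / 3 + radialSum (cNormalized k) (k + 1) k v i t)
    (he : ∀ i t, 0 < t → e (k + 1) i t =
      t * radialSum (sNormalized (k + 1)) (k + 1) (k + 1) v (i + 1) t)
    (i : ℕ) (t : ℝ) (ht : 0 < t) :
    α (k + 1) i t = v i t / 3 + radialSum (cNormalized (k + 1)) (k + 2) (k + 1) v i t := by
  have hc : ∀ i, Continuous (v i) := fun i => (hv i).continuous
  simp only [radialSum_extend (κ := cNormalized k) (n := k + 1) (q := k) (n' := k + 2) (q' := k + 1) (by omega) (by omega)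
    fun l m h => cNormalized_eq_zero (by omega)] at hαk
  have hS := fun (κ : ℕ → ℕ → ℝ) (t : ℝ) (ht : 0 < t) => ((hv i t).hasDerivAt.div_const 3).add
    (hasDerivAt_radialSum κ (k + 2) (k + 1) hc i ht)
  refine sub_eq_zero.1 (eq_zero_of_euler (N := 2 * k + 4) (y := fun t => α (k + 1) i t -
    (v i t / 3 + radialSum (cNormalized (k + 1)) (k + 2) (k + 1) v i t)) (by omega) ?_ ?_ ?_ ht)
  · exact ((hα i).continuous.sub
      (((hc i).div_const 3).add (continuous_radialSum _ _ _ hc _))).continuousAt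
  · exact fun t ht => (hα i t).sub (hS _ t ht).differentiableAt
  · intro t ht
    have hd : deriv (α k i) t = _ :=
      ((hS (cNormalized k) t ht).congr_of_eventuallyEq (by
        filter_upwards [eventually_gt_nhds ht] with r hr using hαk i r hr)).deriv
    have hd' := ((hα i t).hasDerivAt.sub (hS (cNormalized (k + 1)) t ht)).deriv
    have h1 := hA i t ht
    have h2 := radialSum_cNormalized_step k i v t
    rw [← radialSum_sNormalized_shift] at h2
    rw [hd, hαk i t ht, he i t ht] at h1
    refine (congrArg (fun z => t * z + _) hd').trans ?_
    have hmul : ∀ x y : ℝ, t * (x + y / t) = t * x + y := fun x y => by field_simp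
    rw [hmul] at h1
    simp only [mul_sub t, hmul]
    push_cast
    linear_combination h1 - h2

/-- All `i` are treated together because the equation for `e (k + 1) i` involves `α k (i + 1)`. At
`k = 0` all the sums are empty. -/
theorem radial_representation (hv : ∀ i, Differentiable ℝ (v i))
    (hα : ∀ k i, Differentiable ℝ (α k i)) (he : ∀ k i, Differentiable ℝ (e k i))
    (hα0 : ∀ i t, α 0 i t = v i t / 3) (he0 : ∀ i t, e 0 i t = 0)
    (hE : ∀ k i t, 0 < t → t * deriv (e (k + 1) i) t + (2 * k + 3) * e (k + 1) i t =
      t * deriv (e k i) t - 2 * k * e k i t + 2 * (4 * k + 3) * t * α k (i + 1) t)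
    (hA : ∀ k i t, 0 < t → t * deriv (α (k + 1) i) t + (2 * k + 4) * α (k + 1) i t =
      t * deriv (α k i) t - (2 * k + 1) * α k i t -
        t / 2 * ((4 * k + 5) / ((2 * k + 2) * (2 * k + 3)) * e (k + 1) i t)) (k : ℕ) :
    (∀ i t, 0 < t → α k i t = v i t / 3 + radialSum (cNormalized k) (k + 1) k v i t) ∧
    (∀ i t, 0 < t → e k i t = t * radialSum (sNormalized k) k k v (i + 1) t) := by
  induction k with
  | zero => exact ⟨fun i t _ => by simp [hα0, radialSum], fun i t _ => by simp [he0, radialSum]⟩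
  | succ k ih =>
    have h := eq_mul_radialSum_succ hv (he (k + 1)) (hE k) ih.1 ih.2
    exact ⟨eq_add_radialSum_succ hv (hα (k + 1)) (hA k) ih.1 h, h⟩

/-! ### Integration over the sphere -/

instance : IsFiniteMeasure surface := inferInstanceAs (IsFiniteMeasure (Measure.toSphere _))

theorem integrable_surface {F : Type*} [NormedAddCommGroup F] {g : S2 → F}
    (hg : Continuous g) : Integrable g surface :=
  hg.integrable_of_hasCompactSupport (HasCompactSupport.of_compactSpace g)

/-- The action of a linear isometry on the sphere. -/
def sphereMap (A : Space ≃ₗᵢ[ℝ] Space) (ω : S2) : S2 :=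
  ⟨A ω, by simp⟩

theorem continuous_sphereMap (A : Space ≃ₗᵢ[ℝ] Space) : Continuous (sphereMap A) :=
  (A.continuous.comp continuous_subtype_val).subtype_mk _

-- The surface measure of a set is, up to a constant, the volume of the cone over it, and a linear
-- isometry preserves volume and maps cones to cones.
open scoped Pointwise in
theorem measurePreserving_sphereMap (A : Space ≃ₗᵢ[ℝ] Space) :
    MeasurePreserving (sphereMap A) surface surface := by
  refine ⟨(continuous_sphereMap A).measurable, Measure.ext fun t ht => ?_⟩
  rw [Measure.map_apply (continuous_sphereMap A).measurable ht, surface,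
    Measure.toSphere_apply' _ ht,
    Measure.toSphere_apply' _ ((continuous_sphereMap A).measurable ht)]
  congr 1
  rw [← A.measurePreserving.measure_preimage_emb A.toHomeomorph.measurableEmbedding
    (Set.Ioo (0 : ℝ) 1 • (Subtype.val '' t))]
  congr 1
  ext x
  simp only [Set.mem_smul, Set.mem_image, Set.mem_preimage]
  constructor
  · rintro ⟨r, hr, _, ⟨ω, hω, rfl⟩, rfl⟩
    exact ⟨r, hr, _, ⟨_, hω, rfl⟩, by simp [sphereMap]⟩
  · rintro ⟨r, hr, _, ⟨ω, hω, rfl⟩, h⟩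
    refine ⟨r, hr, A.symm ω, ⟨sphereMap A.symm ω, ?_, rfl⟩, ?_⟩
    · convert hω
      ext1
      simp [sphereMap]
    · apply A.injective
      simp [← h]

theorem integral_surface_comp (A : Space ≃ₗᵢ[ℝ] Space) {g : Space → ℝ} (hg : Continuous g) :
    ∫ ω : S2, g (A ω) ∂surface = ∫ ω : S2, g ω ∂surface := by
  conv_rhs => rw [← (measurePreserving_sphereMap A).map_eq]
  exact (integral_map (f := fun ω : S2 => g ω) (continuous_sphereMap A).aemeasurable
    (hg.comp continuous_subtype_val).aestronglyMeasurable).symm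

/-! ### Differentiation under the integral over the sphere -/

section Parametric

variable {E : Type*} [NormedAddCommGroup E] [NormedSpace ℝ E]

theorem fderiv_partial {Φ : E × Space → ℝ} (hΦ : ContDiff ℝ 1 Φ) (x : E) (y : Space) :
    HasFDerivAt (fun x => Φ (x, y)) ((fderiv ℝ Φ (x, y)).comp (ContinuousLinearMap.inl ℝ E Space))
      x :=
  ((hΦ.differentiable one_ne_zero) (x, y)).hasFDerivAt.comp x (hasFDerivAt_prodMk_left x y)

theorem continuous_fderiv_partial {Φ : E × Space → ℝ} (hΦ : ContDiff ℝ 1 Φ) :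
    Continuous fun z : E × Space =>
      (fderiv ℝ Φ z).comp (ContinuousLinearMap.inl ℝ E Space) :=
  (hΦ.continuous_fderiv one_ne_zero).clm_comp continuous_const

theorem hasFDerivAt_integral_surface [FiniteDimensional ℝ E] {Φ : E × Space → ℝ}
    (hΦ : ContDiff ℝ 1 Φ) (x₀ : E) :
    HasFDerivAt (fun x => ∫ ω : S2, Φ (x, ω) ∂surface)
      (∫ ω : S2, (fderiv ℝ Φ (x₀, ω)).comp (ContinuousLinearMap.inl ℝ E Space) ∂surface) x₀ := by
  have : ProperSpace E := FiniteDimensional.proper ℝ E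
  have hcompact : IsCompact (Metric.closedBall x₀ 1 ×ˢ Metric.sphere (0 : Space) 1) :=
    (isCompact_closedBall _ _).prod (isCompact_sphere _ _)
  -- The dominating function is a constant: the derivative is continuous, hence bounded on the
  -- product of a closed ball of parameters and the sphere.
  obtain ⟨C, hC⟩ := hcompact.exists_bound_of_continuousOn
    (continuous_fderiv_partial hΦ).continuousOn
  refine hasFDerivAt_integral_of_dominated_of_fderiv_le (bound := fun _ => C)
    (F' := fun x (ω : S2) => (fderiv ℝ Φ (x, ω)).comp (ContinuousLinearMap.inl ℝ E Space))
    (Metric.closedBall_mem_nhds x₀ one_pos) (Filter.Eventually.of_forall fun x => ?_) ?_ ?_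
    (Filter.Eventually.of_forall fun ω x hx => hC (x, ω) ⟨hx, ω.2⟩) (integrable_const C)
    (Filter.Eventually.of_forall fun ω x _ => fderiv_partial hΦ x ω)
  · exact (integrable_surface (hΦ.continuous.comp
      (continuous_const.prodMk continuous_subtype_val))).aestronglyMeasurable
  · exact integrable_surface (hΦ.continuous.comp (continuous_const.prodMk continuous_subtype_val))
  · exact (integrable_surface ((continuous_fderiv_partial hΦ).comp
      (continuous_const.prodMk continuous_subtype_val))).aestronglyMeasurable

theorem integral_surface_fderiv_apply {Φ : E × Space → ℝ}
    (hΦ : ContDiff ℝ 1 Φ) (x₀ v : E) :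
    (∫ ω : S2, (fderiv ℝ Φ (x₀, ω)).comp (ContinuousLinearMap.inl ℝ E Space) ∂surface) v =
      ∫ ω : S2, fderiv ℝ (fun x => Φ (x, ω)) x₀ v ∂surface := by
  rw [ContinuousLinearMap.integral_apply]
  · exact integral_congr_ae (Filter.Eventually.of_forall fun ω => by
      simp only [(fderiv_partial hΦ x₀ ω).fderiv])
  · exact integrable_surface ((continuous_fderiv_partial hΦ).comp
      (continuous_const.prodMk continuous_subtype_val))

theorem hasDerivAt_integral_surface {Φ : ℝ × Space → ℝ} (hΦ : ContDiff ℝ 1 Φ) {x₀ : ℝ}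
    {D : Space → ℝ} (hD : ∀ y, HasDerivAt (fun x => Φ (x, y)) (D y) x₀) :
    HasDerivAt (fun x => ∫ ω : S2, Φ (x, ω) ∂surface) (∫ ω : S2, D ω ∂surface) x₀ := by
  refine (hasFDerivAt_integral_surface hΦ x₀).hasDerivAt.congr_deriv ?_
  rw [integral_surface_fderiv_apply hΦ]
  exact integral_congr_ae (Filter.Eventually.of_forall fun ω => (hD ω).deriv)

end Parametric

/-- The `j`-th partial derivative on `ℝ³`. -/
def pd (j : Fin 3) (f : Space → ℝ) (x : Space) : ℝ := fderiv ℝ f x (EuclideanSpace.single j 1)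

theorem fderiv_eq_sum_pd (f : Space → ℝ) (x v : Space) :
    fderiv ℝ f x v = v 0 * pd 0 f x + v 1 * pd 1 f x + v 2 * pd 2 f x := by
  have hv : v = v 0 • EuclideanSpace.single 0 1 + v 1 • EuclideanSpace.single 1 1 +
      v 2 • EuclideanSpace.single 2 1 := by
    ext i; fin_cases i <;> simp
  conv_lhs => rw [hv]
  simp only [map_add, map_smul, smul_eq_mul, pd]

theorem contDiff_pd {f : Space → ℝ} (hf : ContDiff ℝ (⊤ : ℕ∞) f) (j : Fin 3) :
    ContDiff ℝ (⊤ : ℕ∞) (pd j f) :=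
  (hf.fderiv_right (by simp)).clm_apply contDiff_const

theorem contDiff_coord (i : Fin 3) {n : WithTop ℕ∞} : ContDiff ℝ n fun x : Space => x i :=
  (EuclideanSpace.proj (𝕜 := ℝ) i).contDiff

theorem sq_add_sq_add_sq (ω : S2) :
    (ω : Space) 0 ^ 2 + (ω : Space) 1 ^ 2 + (ω : Space) 2 ^ 2 = 1 := by
  have h : ‖(ω : Space)‖ = 1 := by simp
  rw [EuclideanSpace.norm_eq, Real.sqrt_eq_one] at h
  simpa [Fin.sum_univ_three] using h

/-! ### Rotations about the coordinate axes -/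

/-- The rotation by the angle `r` in the plane of the coordinates `i`, `j`. -/
def rotate (i j : Fin 3) (r : ℝ) (x : Space) : Space :=
  x + ((Real.cos r - 1) * x i - Real.sin r * x j) • EuclideanSpace.single i 1 +
    ((Real.cos r - 1) * x j + Real.sin r * x i) • EuclideanSpace.single j 1

theorem norm_rotate {i j : Fin 3} (hij : i ≠ j) (r : ℝ) (x : Space) :
    ‖rotate i j r x‖ = ‖x‖ := by
  rw [EuclideanSpace.norm_eq, EuclideanSpace.norm_eq]
  congr 1
  have h := Real.sin_sq_add_cos_sq r
  fin_cases i <;> fin_cases j <;> simp [rotate, Fin.sum_univ_three] at hij ⊢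
  · linear_combination (x 0 ^ 2 + x 1 ^ 2) * h
  · linear_combination (x 0 ^ 2 + x 2 ^ 2) * h
  · linear_combination (x 0 ^ 2 + x 1 ^ 2) * h
  · linear_combination (x 1 ^ 2 + x 2 ^ 2) * h
  · linear_combination (x 0 ^ 2 + x 2 ^ 2) * h
  · linear_combination (x 1 ^ 2 + x 2 ^ 2) * h

/-- `rotate` as a linear isometry. -/
def rotateIsometry {i j : Fin 3} (hij : i ≠ j) (r : ℝ) : Space →ₗᵢ[ℝ] Space where
  toFun := rotate i j r
  map_add' x y := by ext l; simp [rotate]; split_ifs <;> ring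
  map_smul' a x := by ext l; simp [rotate]; split_ifs <;> ring
  norm_map' := norm_rotate hij r

theorem contDiff_rotate (i j : Fin 3) :
    ContDiff ℝ (⊤ : ℕ∞) fun z : ℝ × Space => rotate i j z.1 z.2 := by
  have h : ∀ l : Fin 3, ContDiff ℝ (⊤ : ℕ∞) fun z : ℝ × Space => z.2 l :=
    fun l => (contDiff_coord l).comp contDiff_snd
  have hc : ContDiff ℝ (⊤ : ℕ∞) fun z : ℝ × Space => Real.cos z.1 :=
    Real.contDiff_cos.comp contDiff_fst
  have hs : ContDiff ℝ (⊤ : ℕ∞) fun z : ℝ × Space => Real.sin z.1 :=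
    Real.contDiff_sin.comp contDiff_fst
  exact (contDiff_snd.add ((((hc.sub contDiff_const).mul (h i)).sub (hs.mul (h j))).smul
    contDiff_const)).add ((((hc.sub contDiff_const).mul (h j)).add (hs.mul (h i))).smul
    contDiff_const)

theorem hasDerivAt_rotate (i j : Fin 3) (x : Space) :
    HasDerivAt (fun r => rotate i j r x)
      (x i • EuclideanSpace.single j 1 - x j • EuclideanSpace.single i 1) 0 := by
  have hc := (Real.hasDerivAt_cos 0).sub_const 1
  have hs := Real.hasDerivAt_sin 0
  have h := ((((hc.mul_const (x i)).sub (hs.mul_const (x j))).smul_const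
    (EuclideanSpace.single i (1 : ℝ))).const_add x).add
    (((hc.mul_const (x j)).add (hs.mul_const (x i))).smul_const (EuclideanSpace.single j (1 : ℝ)))
  refine h.congr_deriv ?_
  simp
  abel

/-- The integral of `H` composed with a rotation does not depend on the angle; this is its
derivative at angle `0`. -/
theorem integral_rotation_derivative {i j : Fin 3} (hij : i ≠ j) {H : Space → ℝ}
    (hH : ContDiff ℝ (⊤ : ℕ∞) H) :
    ∫ ω : S2, fderiv ℝ H ω ((ω : Space) i • EuclideanSpace.single j 1 -
      (ω : Space) j • EuclideanSpace.single i 1) ∂surface = 0 := by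
  have hΦ : ContDiff ℝ 1 fun z : ℝ × Space => H (rotate i j z.1 z.2) :=
    (hH.comp (contDiff_rotate i j)).of_le (by exact_mod_cast le_top)
  have h0 : ∀ x, rotate i j 0 x = x := fun x => by simp [rotate]
  have h1 := hasDerivAt_integral_surface hΦ (x₀ := 0)
    (D := fun x => fderiv ℝ H x (x i • EuclideanSpace.single j 1 - x j • EuclideanSpace.single i 1))
    (fun y => by
      have h := ((hH.differentiable (by simp)) (rotate i j 0 y)).hasFDerivAt.comp_hasDerivAt 0
        (hasDerivAt_rotate i j y)
      rwa [h0] at h)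
  have h2 : (fun r : ℝ => ∫ ω : S2, H (rotate i j r ω) ∂surface) =
      fun _ => ∫ ω : S2, H ω ∂surface := funext fun r =>
    integral_surface_comp ((rotateIsometry hij r).toLinearIsometryEquiv rfl) hH.continuous
  rw [h2] at h1
  exact h1.unique (hasDerivAt_const _ _)

/-! ### Weighted spherical means -/

/-- The integral over `S²` of `f(P + t ω) w(ω)`. -/
def weightedMean (f w : Space → ℝ) (P : Plane) (t : ℝ) : ℝ :=
  ∫ ω : S2, f (embed P + t • (ω : Space)) * w ω ∂surface

theorem weightedMean_congr (f : Space → ℝ) {w w' : Space → ℝ} (h : ∀ ω : S2, w ω = w' ω)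
    (P : Plane) (t : ℝ) : weightedMean f w P t = weightedMean f w' P t := by
  simp only [weightedMean, h]

theorem continuous_weighted_integrand {f w : Space → ℝ} (hf : Continuous f) (hw : Continuous w)
    (P : Plane) (t : ℝ) : Continuous fun ω : S2 => f (embed P + t • (ω : Space)) * w ω := by
  have h : Continuous fun ω : S2 => (ω : Space) := continuous_subtype_val
  exact (hf.comp (continuous_const.add (h.const_smul t))).mul (hw.comp h)

theorem weightedMean_add {f w w' : Space → ℝ} (hf : Continuous f) (hw : Continuous w)
    (hw' : Continuous w') (P : Plane) (t : ℝ) :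
    weightedMean f (fun x => w x + w' x) P t = weightedMean f w P t + weightedMean f w' P t := by
  simp only [weightedMean, mul_add]
  exact integral_add (integrable_surface (continuous_weighted_integrand hf hw P t))
    (integrable_surface (continuous_weighted_integrand hf hw' P t))

theorem weightedMean_const_mul (f w : Space → ℝ) (r : ℝ) (P : Plane) (t : ℝ) :
    weightedMean f (fun x => r * w x) P t = r * weightedMean f w P t := by
  simp only [weightedMean, mul_left_comm _ r]
  exact integral_const_mul _ _

theorem weightedMean_add_left {f g w : Space → ℝ} (hf : Continuous f) (hg : Continuous g)
    (hw : Continuous w) (P : Plane) (t : ℝ) :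
    weightedMean (fun x => f x + g x) w P t = weightedMean f w P t + weightedMean g w P t := by
  simp only [weightedMean, add_mul]
  exact integral_add (integrable_surface (continuous_weighted_integrand hf hw P t))
    (integrable_surface (continuous_weighted_integrand hg hw P t))

theorem weightedMean_neg (f w : Space → ℝ) (P : Plane) (t : ℝ) :
    weightedMean f (fun x => -w x) P t = -weightedMean f w P t := by
  simpa using weightedMean_const_mul f w (-1) P t

theorem hasDerivAt_weightedMean {f w : Space → ℝ} (hf : ContDiff ℝ (⊤ : ℕ∞) f)
    (hw : ContDiff ℝ (⊤ : ℕ∞) w) (P : Plane) (t : ℝ) :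
    HasDerivAt (weightedMean f w P)
      (weightedMean (pd 0 f) (fun x => x 0 * w x) P t +
        weightedMean (pd 1 f) (fun x => x 1 * w x) P t +
        weightedMean (pd 2 f) (fun x => x 2 * w x) P t) t := by
  have hΦ : ContDiff ℝ 1 fun z : ℝ × Space => f (embed P + z.1 • z.2) * w z.2 := by
    refine ContDiff.of_le (n := (⊤ : ℕ∞)) ?_ (by exact_mod_cast le_top)
    exact (hf.comp (contDiff_const.add (contDiff_fst.smul contDiff_snd))).mul
      (hw.comp contDiff_snd)
  have h := hasDerivAt_integral_surface hΦ (x₀ := t)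
    (D := fun y => fderiv ℝ f (embed P + t • y) y * w y) (fun y => by
      have h1 : HasDerivAt (fun r : ℝ => embed P + r • y) y t := by
        simpa using ((hasDerivAt_id t).smul_const y).const_add (embed P)
      exact (((hf.differentiable (by simp)) _).hasFDerivAt.comp_hasDerivAt t h1).mul_const (w y))
  refine h.congr_deriv ?_
  have hc : ∀ j : Fin 3, Integrable (fun ω : S2 => pd j f (embed P + t • (ω : Space)) *
      ((ω : Space) j * w ω)) surface := fun j => integrable_surface
    (continuous_weighted_integrand (contDiff_pd hf j).continuous
      ((contDiff_coord (n := 0) j).continuous.mul hw.continuous) P t)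
  simp only [weightedMean]
  have hc01 : Integrable (fun ω : S2 =>
      pd 0 f (embed P + t • (ω : Space)) * ((ω : Space) 0 * w ω) +
        pd 1 f (embed P + t • (ω : Space)) * ((ω : Space) 1 * w ω)) surface := (hc 0).add (hc 1)
  rw [← integral_add (hc 0) (hc 1), ← integral_add hc01 (hc 2)]
  refine integral_congr_ae (Filter.Eventually.of_forall fun ω => ?_)
  simp only [fderiv_eq_sum_pd]
  ring

/-- `embed` as a continuous linear map. -/
def embedL : Plane →L[ℝ] Space :=
  LinearMap.toContinuousLinearMap
    { toFun := embed
      map_add' := fun P Q => by ext i; fin_cases i <;> simp [embed]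
      map_smul' := fun r P => by ext i; fin_cases i <;> simp [embed] }

theorem embedL_apply (P : Plane) : embedL P = embed P := rfl

theorem contDiff_embed {n : WithTop ℕ∞} : ContDiff ℝ n embed := embedL.contDiff

theorem hasFDerivAt_weightedMean {f w : Space → ℝ} (hf : ContDiff ℝ (⊤ : ℕ∞) f)
    (hw : ContDiff ℝ (⊤ : ℕ∞) w) (P : Plane) (t : ℝ) :
    ∃ D : Plane →L[ℝ] ℝ, HasFDerivAt (fun Q => weightedMean f w Q t) D P ∧
      ∀ v, D v = weightedMean (fun x => fderiv ℝ f x (embed v)) w P t := by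
  have hΦ : ContDiff ℝ 1 fun z : Plane × Space => f (embed z.1 + t • z.2) * w z.2 := by
    refine ContDiff.of_le (n := (⊤ : ℕ∞)) ?_ (by exact_mod_cast le_top)
    exact (hf.comp ((contDiff_embed.comp contDiff_fst).add (contDiff_snd.const_smul t))).mul
      (hw.comp contDiff_snd)
  refine ⟨_, hasFDerivAt_integral_surface hΦ P, fun v => ?_⟩
  rw [integral_surface_fderiv_apply hΦ]
  refine integral_congr_ae (Filter.Eventually.of_forall fun ω => ?_)
  have h1 : HasFDerivAt (fun Q : Plane => embed Q + t • (ω : Space)) embedL P :=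
    embedL.hasFDerivAt.add_const _
  have h2 := (((hf.differentiable (by simp)) (embed P + t • (ω : Space))).hasFDerivAt.comp P
    h1).mul_const (w ω)
  have h3 := congrArg (fun L => L v) h2.fderiv
  refine h3.trans ?_
  simp [embedL_apply, mul_comm]

theorem fderiv_weightedMean {f w : Space → ℝ} (hf : ContDiff ℝ (⊤ : ℕ∞) f)
    (hw : ContDiff ℝ (⊤ : ℕ∞) w) (P v : Plane) (t : ℝ) :
    fderiv ℝ (fun Q => weightedMean f w Q t) P v =
      weightedMean (fun x => fderiv ℝ f x (embed v)) w P t := by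
  obtain ⟨D, hD, h⟩ := hasFDerivAt_weightedMean hf hw P t
  rw [hD.fderiv, h]

theorem differentiable_weightedMean {f w : Space → ℝ} (hf : ContDiff ℝ (⊤ : ℕ∞) f)
    (hw : ContDiff ℝ (⊤ : ℕ∞) w) (t : ℝ) : Differentiable ℝ fun Q => weightedMean f w Q t :=
  fun P => (hasFDerivAt_weightedMean hf hw P t).choose_spec.1.differentiableAt

/-- Differentiating in `P` replaces `f` by a directional derivative, again smooth, so the induction
on the order runs over all `f`. -/
theorem contDiff_weightedMean {f w : Space → ℝ} (hf : ContDiff ℝ (⊤ : ℕ∞) f)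
    (hw : ContDiff ℝ (⊤ : ℕ∞) w) (t : ℝ) :
    ContDiff ℝ (⊤ : ℕ∞) fun Q => weightedMean f w Q t := by
  refine contDiff_infty.2 fun n => ?_
  induction n generalizing f with
  | zero => exact contDiff_zero.2 (differentiable_weightedMean hf hw t).continuous
  | succ n ih =>
    push_cast
    refine contDiff_succ_iff_fderiv_apply.2
      ⟨differentiable_weightedMean hf hw t, by simp, fun v => ?_⟩
    simp only [fderiv_weightedMean hf hw]
    exact ih ((hf.fderiv_right (by simp)).clm_apply contDiff_const)

theorem embed_single_zero : embed (EuclideanSpace.single 0 1) = EuclideanSpace.single 0 1 := by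
  ext i; fin_cases i <;> simp [embed]

theorem embed_single_one : embed (EuclideanSpace.single 1 1) = EuclideanSpace.single 1 1 := by
  ext i; fin_cases i <;> simp [embed]

theorem partialP_weightedMean {f w : Space → ℝ} (hf : ContDiff ℝ (⊤ : ℕ∞) f)
    (hw : ContDiff ℝ (⊤ : ℕ∞) w) (P : Plane) (t : ℝ) :
    partialP (fun Q => weightedMean f w Q t) P = weightedMean (pd 0 f) w P t := by
  rw [partialP, (differentiable_weightedMean hf hw t P).lineDeriv_eq_fderiv,
    fderiv_weightedMean hf hw, embed_single_zero]
  rfl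

theorem partialQ_weightedMean {f w : Space → ℝ} (hf : ContDiff ℝ (⊤ : ℕ∞) f)
    (hw : ContDiff ℝ (⊤ : ℕ∞) w) (P : Plane) (t : ℝ) :
    partialQ (fun Q => weightedMean f w Q t) P = weightedMean (pd 1 f) w P t := by
  rw [partialQ, (differentiable_weightedMean hf hw t P).lineDeriv_eq_fderiv,
    fderiv_weightedMean hf hw, embed_single_one]
  rfl

/-- The horizontal Laplacian `∂ₓ² + ∂ᵧ²` on `ℝ³`. -/
def horizontalLaplacian (f : Space → ℝ) (x : Space) : ℝ := pd 0 (pd 0 f) x + pd 1 (pd 1 f) x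

theorem contDiff_horizontalLaplacian {f : Space → ℝ} (hf : ContDiff ℝ (⊤ : ℕ∞) f) :
    ContDiff ℝ (⊤ : ℕ∞) (horizontalLaplacian f) :=
  (contDiff_pd (contDiff_pd hf 0) 0).add (contDiff_pd (contDiff_pd hf 1) 1)

theorem contDiff_iterate_horizontalLaplacian {f : Space → ℝ} (hf : ContDiff ℝ (⊤ : ℕ∞) f)
    (i : ℕ) : ContDiff ℝ (⊤ : ℕ∞) (horizontalLaplacian^[i] f) := by
  induction i with
  | zero => exact hf
  | succ i ih =>
    rw [Function.iterate_succ_apply']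
    exact contDiff_horizontalLaplacian ih

theorem laplacian_weightedMean {f w : Space → ℝ} (hf : ContDiff ℝ (⊤ : ℕ∞) f)
    (hw : ContDiff ℝ (⊤ : ℕ∞) w) (t : ℝ) :
    Laplacian.laplacian (fun Q => weightedMean f w Q t) =
      fun P => weightedMean (horizontalLaplacian f) w P t := by
  have h2 : ∀ (v : Plane) (P : Plane),
      iteratedFDeriv ℝ 2 (fun Q => weightedMean f w Q t) P ![v, v] =
        weightedMean (fun x => fderiv ℝ (fun y => fderiv ℝ f y (embed v)) x (embed v)) w P t := by
    intro v P
    rw [iteratedFDeriv_two_apply, ← fderiv_weightedMean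
      ((hf.fderiv_right (by simp)).clm_apply contDiff_const) hw]
    simp only [← fderiv_weightedMean hf hw]
    have hd : DifferentiableAt ℝ (fderiv ℝ fun Q => weightedMean f w Q t) P :=
      (((contDiff_weightedMean hf hw t).fderiv_right (m := (⊤ : ℕ∞)) (by simp)).differentiable
        (by simp)) P
    have := (hd.hasFDerivAt.clm_apply (hasFDerivAt_const v P)).fderiv
    rw [this]
    simp
  rw [InnerProductSpace.laplacian_eq_iteratedFDeriv_orthonormalBasis _
    (EuclideanSpace.basisFun (Fin 2) ℝ)]
  funext P
  simp only [Fin.sum_univ_two, EuclideanSpace.basisFun_apply, h2, embed_single_zero,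
    embed_single_one]
  exact (weightedMean_add_left (contDiff_pd (contDiff_pd hf 0) 0).continuous
    (contDiff_pd (contDiff_pd hf 1) 1).continuous hw.continuous P t).symm

theorem iterate_laplacian_weightedMean {f w : Space → ℝ} (hf : ContDiff ℝ (⊤ : ℕ∞) f)
    (hw : ContDiff ℝ (⊤ : ℕ∞) w) (t : ℝ) (i : ℕ) :
    Laplacian.laplacian^[i] (fun Q => weightedMean f w Q t) =
      fun P => weightedMean (horizontalLaplacian^[i] f) w P t := by
  induction i with
  | zero => rfl
  | succ i ih =>
    rw [Function.iterate_succ_apply', ih,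
      laplacian_weightedMean (contDiff_iterate_horizontalLaplacian hf i) hw,
      Function.iterate_succ_apply']

/-! ### Integration by parts -/

/-- The vanishing integral is applied to the product of `x ↦ f (embed P + t • x)` and `w`; the
factor `t` comes from the chain rule. -/
theorem rotation_integration_by_parts {f w : Space → ℝ} (hf : ContDiff ℝ (⊤ : ℕ∞) f)
    (hw : ContDiff ℝ (⊤ : ℕ∞) w) {i j : Fin 3} (hij : i ≠ j) (P : Plane) (t : ℝ) :
    t * (weightedMean (pd j f) (fun x => x i * w x) P t -
      weightedMean (pd i f) (fun x => x j * w x) P t) =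
      -weightedMean f (fun x => x i * pd j w x - x j * pd i w x) P t := by
  have hF : ContDiff ℝ (⊤ : ℕ∞) fun x : Space => f (embed P + t • x) :=
    hf.comp (contDiff_const.add (contDiff_id.const_smul t))
  have h := integral_rotation_derivative hij (hF.mul hw)
  have hco : ∀ l : Fin 3, Continuous fun x : Space => x l :=
    fun l => (contDiff_coord (n := 0) l).continuous
  have e : ∀ l l' : Fin 3, Integrable (fun ω : S2 => pd l f (embed P + t • (ω : Space)) *
      ((ω : Space) l' * w ω)) surface := fun l l' => integrable_surface
    (continuous_weighted_integrand (contDiff_pd hf l).continuous ((hco l').mul hw.continuous) P t)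
  have e1 : Integrable (fun ω : S2 => t * (pd j f (embed P + t • (ω : Space)) *
      ((ω : Space) i * w ω) - pd i f (embed P + t • (ω : Space)) * ((ω : Space) j * w ω)))
      surface := ((e j i).sub (e i j)).const_mul t
  have e2 : Integrable (fun ω : S2 => f (embed P + t • (ω : Space)) *
      ((ω : Space) i * pd j w ω - (ω : Space) j * pd i w ω)) surface :=
    integrable_surface (continuous_weighted_integrand hf.continuous
      (((hco i).mul (contDiff_pd hw j).continuous).sub
        ((hco j).mul (contDiff_pd hw i).continuous)) P t)
  rw [eq_neg_iff_add_eq_zero, ← h]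
  simp only [weightedMean]
  rw [← integral_sub (e j i) (e i j), ← integral_const_mul, ← integral_add e1 e2]
  refine integral_congr_ae (Filter.Eventually.of_forall fun ω => ?_)
  have h1 : HasFDerivAt (fun x : Space => embed P + t • x) (t • ContinuousLinearMap.id ℝ Space)
      (ω : Space) := ((hasFDerivAt_id (𝕜 := ℝ) (ω : Space)).const_smul t).const_add _
  have h2 := ((hf.differentiable (by simp)) (embed P + t • (ω : Space))).hasFDerivAt.comp
    (ω : Space) h1
  have h3 := h2.mul ((hw.differentiable (by simp)) (ω : Space)).hasFDerivAt
  have h4 := congrArg (fun L => L ((ω : Space) i • EuclideanSpace.single j 1 -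
    (ω : Space) j • EuclideanSpace.single i 1)) h3.fderiv
  refine Eq.trans ?_ h4.symm
  simp [pd, smul_eq_mul]
  ring

/-! ### Zonal means and their Euler equations -/

open Polynomial in
theorem contDiff_eval_coord (q : ℝ[X]) {n : WithTop ℕ∞} :
    ContDiff ℝ n fun x : Space => q.eval (x 2) :=
  ContDiff.comp (g := fun y : ℝ => q.eval y) (by simpa using q.contDiff_aeval (𝕜 := ℝ) n)
    (contDiff_coord 2)

open Polynomial in
theorem contDiff_coord_mul_eval (l : Fin 3) (q : ℝ[X]) {n : WithTop ℕ∞} :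
    ContDiff ℝ n fun x : Space => x l * q.eval (x 2) :=
  (contDiff_coord l).mul (contDiff_eval_coord q)

open Polynomial in
theorem pd_coord_mul_eval (j l : Fin 3) (q : ℝ[X]) (x : Space) :
    pd j (fun x : Space => x l * q.eval (x 2)) x =
      (if l = j then 1 else 0) * q.eval (x 2) +
        x l * ((if 2 = j then 1 else 0) * (derivative q).eval (x 2)) := by
  have h : ∀ l : Fin 3, HasFDerivAt (fun x : Space => x l) (EuclideanSpace.proj (𝕜 := ℝ) l) x :=
    fun l => (EuclideanSpace.proj (𝕜 := ℝ) l).hasFDerivAt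
  have h1 := (h l).mul ((q.hasDerivAt (x 2)).comp_hasFDerivAt x (h 2))
  rw [pd]
  refine (congrArg (fun L => L (EuclideanSpace.single j 1)) h1.fderiv).trans ?_
  simp
  split_ifs <;> ring

/-- The integral of `f(P + t ω) q(cos θ)` over `S²`. -/
def zonalMean (f : Space → ℝ) (q : Polynomial ℝ) (P : Plane) (t : ℝ) : ℝ :=
  weightedMean f (fun x => q.eval (x 2)) P t

/-- The integral of `(x ∂ₓ f + y ∂ᵧ f)(P + t ω) q(cos θ)` over `S²`, where `ω = (x, y, z)`. -/
def divergenceMean (f : Space → ℝ) (q : Polynomial ℝ) (P : Plane) (t : ℝ) : ℝ :=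
  weightedMean (pd 0 f) (fun x => x 0 * q.eval (x 2)) P t +
    weightedMean (pd 1 f) (fun x => x 1 * q.eval (x 2)) P t

variable {f : Space → ℝ}

section
open Polynomial

theorem weightedMean_coord_add (hf : ContDiff ℝ (⊤ : ℕ∞) f) (l : Fin 3) (p q : ℝ[X]) (P : Plane)
    (t : ℝ) : weightedMean f (fun x => x l * (p + q).eval (x 2)) P t =
      weightedMean f (fun x => x l * p.eval (x 2)) P t +
        weightedMean f (fun x => x l * q.eval (x 2)) P t := by
  simp only [eval_add, mul_add]
  exact weightedMean_add hf.continuous (contDiff_coord_mul_eval (n := 0) l p).continuous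
    (contDiff_coord_mul_eval (n := 0) l q).continuous P t

theorem weightedMean_coord_C_mul (l : Fin 3) (r : ℝ) (q : ℝ[X]) (P : Plane)
    (t : ℝ) : weightedMean f (fun x => x l * (C r * q).eval (x 2)) P t =
      r * weightedMean f (fun x => x l * q.eval (x 2)) P t := by
  simp only [eval_mul, eval_C, mul_left_comm _ r]
  exact weightedMean_const_mul _ _ _ _ _

theorem divergenceMean_add (hf : ContDiff ℝ (⊤ : ℕ∞) f) (p q : ℝ[X]) (P : Plane) (t : ℝ) :
    divergenceMean f (p + q) P t = divergenceMean f p P t + divergenceMean f q P t := by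
  simp only [divergenceMean, weightedMean_coord_add (contDiff_pd hf _)]
  ring

theorem divergenceMean_C_mul (r : ℝ) (q : ℝ[X]) (P : Plane) (t : ℝ) :
    divergenceMean f (C r * q) P t = r * divergenceMean f q P t := by
  simp only [divergenceMean, weightedMean_coord_C_mul]
  ring

theorem zonalMean_add (hf : ContDiff ℝ (⊤ : ℕ∞) f) (p q : ℝ[X]) (P : Plane) (t : ℝ) :
    zonalMean f (p + q) P t = zonalMean f p P t + zonalMean f q P t := by
  simp only [zonalMean, eval_add]
  exact weightedMean_add hf.continuous (contDiff_eval_coord (n := 0) p).continuous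
    (contDiff_eval_coord (n := 0) q).continuous P t

theorem zonalMean_C_mul (r : ℝ) (q : ℝ[X]) (P : Plane) (t : ℝ) :
    zonalMean f (C r * q) P t = r * zonalMean f q P t := by
  simp only [zonalMean, eval_mul, eval_C]
  exact weightedMean_const_mul _ _ _ _ _

theorem differentiable_zonalMean (hf : ContDiff ℝ (⊤ : ℕ∞) f) (q : ℝ[X]) (P : Plane) :
    Differentiable ℝ (zonalMean f q P) :=
  fun t => (hasDerivAt_weightedMean hf (contDiff_eval_coord q) P t).differentiableAt

theorem differentiable_weightedMean_coord (hf : ContDiff ℝ (⊤ : ℕ∞) f) (l : Fin 3) (q : ℝ[X])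
    (P : Plane) : Differentiable ℝ (weightedMean f (fun x => x l * q.eval (x 2)) P) :=
  fun t => (hasDerivAt_weightedMean hf (contDiff_coord_mul_eval l q) P t).differentiableAt

theorem differentiable_divergenceMean (hf : ContDiff ℝ (⊤ : ℕ∞) f) (q : ℝ[X]) (P : Plane) :
    Differentiable ℝ (divergenceMean f q P) :=
  (differentiable_weightedMean_coord (contDiff_pd hf 0) 0 q P).add
    (differentiable_weightedMean_coord (contDiff_pd hf 1) 1 q P)

theorem sq_coord_sum {j l : Fin 3} (hj : j ≠ 2) (hl : l ≠ 2) (hjl : j ≠ l) (ω : S2) :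
    (ω : Space) j ^ 2 + (ω : Space) l ^ 2 + (ω : Space) 2 ^ 2 = 1 := by
  have h := sq_add_sq_add_sq ω
  fin_cases j <;> fin_cases l <;> simp at hj hl hjl ⊢ <;> linarith

/-- The tangential part of the identity for `∂ⱼ` of a zonal mean, `j` a horizontal index. -/
theorem pd_zonal_identity (hf : ContDiff ℝ (⊤ : ℕ∞) f) {j l : Fin 3} (hj : j ≠ 2) (hl : l ≠ 2)
    (hjl : j ≠ l) (q : ℝ[X]) (P : Plane) (t : ℝ) :
    t * zonalMean (pd j f) q P t =
      t * (weightedMean (pd j f) (fun x => x j * (x j * q.eval (x 2))) P t +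
        weightedMean (pd l f) (fun x => x l * (x j * q.eval (x 2))) P t +
        weightedMean (pd 2 f) (fun x => x 2 * (x j * q.eval (x 2))) P t) +
      weightedMean f (fun x => x j * (2 * q + X * derivative q).eval (x 2)) P t := by
  have r1 := rotation_integration_by_parts hf (contDiff_coord_mul_eval l q) hjl.symm P t
  have r2 := rotation_integration_by_parts hf (contDiff_coord_mul_eval 2 q) hj.symm P t
  have hcd : ∀ i i' : Fin 3, Continuous fun x : Space => x i * (x i' * q.eval (x 2)) :=
    fun i i' => (contDiff_coord (n := 0) i).continuous.mul
      (contDiff_coord_mul_eval (n := 0) i' q).continuous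
  -- The factor `1 = x_j² + x_l² + x_2²` is inserted. Rotations then turn `x_i² ∂_j f` into `x_i x_j
  -- ∂_i f` for `i ≠ j`, which assembles the radial derivative with weight `x_j q`.
  have h1 : zonalMean (pd j f) q P t =
      weightedMean (pd j f) (fun x => x j * (x j * q.eval (x 2))) P t +
      weightedMean (pd j f) (fun x => x l * (x l * q.eval (x 2))) P t +
      weightedMean (pd j f) (fun x => x 2 * (x 2 * q.eval (x 2))) P t := by
    have hc := (contDiff_pd hf j).continuous
    have hcjl : Continuous fun x : Space => x j * (x j * q.eval (x 2)) + x l * (x l * q.eval (x 2)) :=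
      (hcd j j).add (hcd l l)
    rw [← weightedMean_add hc (hcd j j) (hcd l l), ← weightedMean_add hc hcjl (hcd 2 2)]
    refine weightedMean_congr _ (fun ω => ?_) P t
    linear_combination -(q.eval ((ω : Space) 2)) * sq_coord_sum hj hl hjl ω
  have h2 : weightedMean f (fun x => x j * (2 * q + X * derivative q).eval (x 2)) P t =
      weightedMean f (fun x => x j * q.eval (x 2)) P t +
      weightedMean f (fun x => x j * (q + X * derivative q).eval (x 2)) P t := by
    rw [← weightedMean_coord_add hf, ← add_assoc, two_mul]
  have h3 : weightedMean f (fun x => x l * pd j (fun x => x l * q.eval (x 2)) x -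
      x j * pd l (fun x => x l * q.eval (x 2)) x) P t =
      -weightedMean f (fun x => x j * q.eval (x 2)) P t := by
    rw [← weightedMean_neg]
    refine weightedMean_congr _ (fun ω => ?_) P t
    simp [pd_coord_mul_eval, hj.symm, hl.symm, hjl.symm]
  have h4 : weightedMean f (fun x => x 2 * pd j (fun x => x 2 * q.eval (x 2)) x -
      x j * pd 2 (fun x => x 2 * q.eval (x 2)) x) P t =
      -weightedMean f (fun x => x j * (q + X * derivative q).eval (x 2)) P t := by
    rw [← weightedMean_neg]
    refine weightedMean_congr _ (fun ω => ?_) P t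
    simp [pd_coord_mul_eval, hj.symm]
  have h5 : weightedMean (pd l f) (fun x => x j * (x l * q.eval (x 2))) P t =
      weightedMean (pd l f) (fun x => x l * (x j * q.eval (x 2))) P t :=
    weightedMean_congr _ (fun ω => by ring) P t
  have h6 : weightedMean (pd 2 f) (fun x => x j * (x 2 * q.eval (x 2))) P t =
      weightedMean (pd 2 f) (fun x => x 2 * (x j * q.eval (x 2))) P t :=
    weightedMean_congr _ (fun ω => by ring) P t
  rw [h3, h5] at r1
  rw [h4, h6] at r2
  rw [h1, h2]
  linear_combination r1 + r2

theorem euler_zonal_pd (hf : ContDiff ℝ (⊤ : ℕ∞) f) {j : Fin 3} (hj : j ≠ 2) (q : ℝ[X]) (P : Plane)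
    (t : ℝ) : t * zonalMean (pd j f) q P t =
      t * deriv (weightedMean f (fun x => x j * q.eval (x 2)) P) t +
      weightedMean f (fun x => x j * (2 * q + X * derivative q).eval (x 2)) P t := by
  rw [(hasDerivAt_weightedMean hf (contDiff_coord_mul_eval j q) P t).deriv]
  have hj' : j = 0 ∨ j = 1 := by omega
  rcases hj' with rfl | rfl
  · exact pd_zonal_identity hf (by decide) (by decide) (by decide : (0 : Fin 3) ≠ 1) q P t
  · rw [pd_zonal_identity hf (by decide) (by decide) (by decide : (1 : Fin 3) ≠ 0) q P t]
    ring

theorem euler_divergenceMean (hf : ContDiff ℝ (⊤ : ℕ∞) f) (q : ℝ[X]) (P : Plane) (t : ℝ) :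
    t * zonalMean (horizontalLaplacian f) q P t =
      t * deriv (divergenceMean f q P) t + divergenceMean f (2 * q + X * derivative q) P t := by
  have h0 := contDiff_pd hf 0
  have h1 := contDiff_pd hf 1
  have e0 := euler_zonal_pd h0 (by decide : (0 : Fin 3) ≠ 2) q P t
  have e1 := euler_zonal_pd h1 (by decide : (1 : Fin 3) ≠ 2) q P t
  have hL : zonalMean (horizontalLaplacian f) q P t =
      zonalMean (pd 0 (pd 0 f)) q P t + zonalMean (pd 1 (pd 1 f)) q P t :=
    weightedMean_add_left (contDiff_pd h0 0).continuous (contDiff_pd h1 1).continuous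
      (contDiff_eval_coord (n := 0) q).continuous P t
  have hd : deriv (divergenceMean f q P) t =
      deriv (weightedMean (pd 0 f) (fun x => x 0 * q.eval (x 2)) P) t +
        deriv (weightedMean (pd 1 f) (fun x => x 1 * q.eval (x 2)) P) t :=
    deriv_add (differentiable_weightedMean_coord h0 0 q P t)
      (differentiable_weightedMean_coord h1 1 q P t)
  rw [hL, hd, divergenceMean]
  linear_combination e0 + e1

theorem euler_zonalMean (hf : ContDiff ℝ (⊤ : ℕ∞) f) (q : ℝ[X]) (P : Plane) (t : ℝ) :
    t * divergenceMean f q P t =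
      t * deriv (zonalMean f ((1 - X ^ 2) * q) P) t +
        zonalMean f ((1 - X ^ 2) * q + X * derivative ((1 - X ^ 2) * q)) P t := by
  have r0 := rotation_integration_by_parts hf (contDiff_coord_mul_eval 0 (X * q))
    (by decide : (2 : Fin 3) ≠ 0) P t
  have r1 := rotation_integration_by_parts hf (contDiff_coord_mul_eval 1 (X * q))
    (by decide : (2 : Fin 3) ≠ 1) P t
  have hcd : ∀ (i i' : Fin 3) (q : ℝ[X]), Continuous fun x : Space => x i * (x i' * q.eval (x 2)) :=
    fun i i' q => (contDiff_coord (n := 0) i).continuous.mul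
      (contDiff_coord_mul_eval (n := 0) i' q).continuous
  have hd := (hasDerivAt_weightedMean hf (contDiff_eval_coord ((1 - X ^ 2) * q)) P t).deriv
  -- The split `q = (1 - X²) q + X² q` isolates the horizontal part of the radial derivative with
  -- weight `(1 - X²) q`. Rotations with weights `x_j * (X * q)`, `j = 0, 1`, turn the remainder
  -- into its vertical part, as `1 - x_2² = x_0² + x_1²`.
  have hsplit : ∀ j : Fin 3, weightedMean (pd j f) (fun x => x j * q.eval (x 2)) P t =
      weightedMean (pd j f) (fun x => x j * ((1 - X ^ 2) * q).eval (x 2)) P t +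
        weightedMean (pd j f) (fun x => x 2 * (x j * (X * q).eval (x 2))) P t := fun j => by
    rw [← weightedMean_add (contDiff_pd hf j).continuous
      (contDiff_coord_mul_eval (n := 0) j _).continuous (hcd 2 j _)]
    refine weightedMean_congr _ (fun ω => ?_) P t
    simp
    ring
  have h2 : weightedMean (pd 2 f) (fun x => x 2 * ((1 - X ^ 2) * q).eval (x 2)) P t =
      weightedMean (pd 2 f) (fun x => x 0 * (x 0 * (X * q).eval (x 2))) P t +
        weightedMean (pd 2 f) (fun x => x 1 * (x 1 * (X * q).eval (x 2))) P t := by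
    rw [← weightedMean_add (contDiff_pd hf 2).continuous (hcd 0 0 _) (hcd 1 1 _)]
    refine weightedMean_congr _ (fun ω => ?_) P t
    simp
    linear_combination -((ω : Space) 2 * q.eval ((ω : Space) 2)) * sq_add_sq_add_sq ω
  have hcW : ∀ j : Fin 3, Continuous fun x : Space =>
      x 2 * pd j (fun x => x j * (X * q).eval (x 2)) x -
        x j * pd 2 (fun x => x j * (X * q).eval (x 2)) x := fun j =>
    (((contDiff_coord 2).mul (contDiff_pd (contDiff_coord_mul_eval j _) j)).sub
      ((contDiff_coord j).mul (contDiff_pd (contDiff_coord_mul_eval j _) 2))).continuous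
  have h3 : zonalMean f ((1 - X ^ 2) * q + X * derivative ((1 - X ^ 2) * q)) P t =
      -(weightedMean f (fun x => x 2 * pd 0 (fun x => x 0 * (X * q).eval (x 2)) x -
        x 0 * pd 2 (fun x => x 0 * (X * q).eval (x 2)) x) P t +
      weightedMean f (fun x => x 2 * pd 1 (fun x => x 1 * (X * q).eval (x 2)) x -
        x 1 * pd 2 (fun x => x 1 * (X * q).eval (x 2)) x) P t) := by
    rw [← weightedMean_add hf.continuous (hcW 0) (hcW 1), ← weightedMean_neg]
    refine weightedMean_congr _ (fun ω => ?_) P t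
    simp only [pd_coord_mul_eval]
    simp
    linear_combination (-(q.eval ((ω : Space) 2)) -
      (ω : Space) 2 * (derivative q).eval ((ω : Space) 2)) * sq_add_sq_add_sq ω
  have hd' : deriv (zonalMean f ((1 - X ^ 2) * q) P) t = _ := hd
  rw [h3, hd', h2, divergenceMean, hsplit 0, hsplit 1]
  linear_combination r0 + r1

end

section
open Polynomial

/-! ### The Fourier coefficients as weighted means -/

theorem cos_polar (ω : S2) : Real.cos (polar ω) = (ω : Space) 2 := by
  have h := sq_add_sq_add_sq ω
  exact Real.cos_arccos (by nlinarith [sq_nonneg ((ω : Space) 0), sq_nonneg ((ω : Space) 1)])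
    (by nlinarith [sq_nonneg ((ω : Space) 0), sq_nonneg ((ω : Space) 1)])

theorem sqrt_one_sub_sq (ω : S2) :
    Real.sqrt (1 - (ω : Space) 2 ^ 2) = ‖(⟨(ω : Space) 0, (ω : Space) 1⟩ : ℂ)‖ := by
  rw [Complex.norm_def, Complex.normSq_mk]
  congr 1
  linear_combination -sq_add_sq_add_sq ω

/-- The two signs cancel and `sin θ cos φ` is the first coordinate. At the poles the value of the
azimuth is irrelevant since `sin θ = 0`. -/
theorem signedLegendre_one_mul_cos_azimuth (n : ℕ) (ω : S2) :
    signedLegendre n 1 (Real.cos (polar ω)) * Real.cos (((1 : ℕ) : ℝ) * azimuth ω) =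
      (ω : Space) 0 * (derivative (legendre n)).eval ((ω : Space) 2) := by
  have h := Complex.norm_mul_cos_arg ⟨(ω : Space) 0, (ω : Space) 1⟩
  rw [cos_polar, signedLegendre, assocLegendre, sqrt_one_sub_sq, azimuth, Nat.cast_one, one_mul,
    Function.iterate_one]
  simp only [pow_one] at h ⊢
  linear_combination (derivative (legendre n)).eval ((ω : Space) 2) * h

theorem signedLegendre_one_mul_sin_azimuth (n : ℕ) (ω : S2) :
    signedLegendre n 1 (Real.cos (polar ω)) * Real.sin (((1 : ℕ) : ℝ) * azimuth ω) =
      (ω : Space) 1 * (derivative (legendre n)).eval ((ω : Space) 2) := by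
  have h := Complex.norm_mul_sin_arg ⟨(ω : Space) 0, (ω : Space) 1⟩
  rw [cos_polar, signedLegendre, assocLegendre, sqrt_one_sub_sq, azimuth, Nat.cast_one, one_mul,
    Function.iterate_one]
  simp only [pow_one] at h ⊢
  linear_combination (derivative (legendre n)).eval ((ω : Space) 2) * h

theorem a0_eq (f : Space → ℝ) (n : ℕ) (P : Plane) (t : ℝ) :
    a0 f n P t = zonalMean f (C ((2 * (n : ℝ) + 1) / (4 * Real.pi)) * legendre n) P t := by
  rw [zonalMean_C_mul, a0]
  simp only [cos_polar]
  rfl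

/-- The normalizing factor of `a_{1n}` and `b_{1n}`. -/
def sectoralFactor (n : ℕ) : ℝ :=
  (2 * (n : ℝ) + 1) / (2 * Real.pi) * (((n - 1).factorial : ℝ) / ((n + 1).factorial : ℝ))

theorem a_one_eq (f : Space → ℝ) (n : ℕ) (P : Plane) (t : ℝ) :
    a f 1 n P t = weightedMean f
      (fun x => x 0 * (C (sectoralFactor n) * derivative (legendre n)).eval (x 2)) P t := by
  rw [weightedMean_coord_C_mul, a]
  simp only [mul_assoc, signedLegendre_one_mul_cos_azimuth, sectoralFactor]
  rfl

theorem b_one_eq (f : Space → ℝ) (n : ℕ) (P : Plane) (t : ℝ) :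
    b f 1 n P t = weightedMean f
      (fun x => x 1 * (C (sectoralFactor n) * derivative (legendre n)).eval (x 2)) P t := by
  rw [weightedMean_coord_C_mul, b]
  simp only [mul_assoc, signedLegendre_one_mul_sin_azimuth, sectoralFactor]
  rfl

theorem partialP_a_add_partialQ_b (hf : ContDiff ℝ (⊤ : ℕ∞) f) (n : ℕ) (P : Plane) (t : ℝ) :
    partialP (fun Q => a f 1 n Q t) P + partialQ (fun Q => b f 1 n Q t) P =
      sectoralFactor n * divergenceMean f (derivative (legendre n)) P t := by
  simp only [a_one_eq, b_one_eq]
  rw [partialP_weightedMean hf (contDiff_coord_mul_eval 0 _),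
    partialQ_weightedMean hf (contDiff_coord_mul_eval 1 _), ← divergenceMean_C_mul]
  rfl

theorem lap_a0 (hf : ContDiff ℝ (⊤ : ℕ∞) f) (i n : ℕ) (P : Plane) (u : ℝ) :
    lap i (a0 f n) P u = a0 (horizontalLaplacian^[i] f) n P u := by
  simp only [lap, a0_eq, zonalMean]
  rw [iterate_laplacian_weightedMean hf (contDiff_eval_coord _)]

theorem differentiable_a0 (hf : ContDiff ℝ (⊤ : ℕ∞) f) (n : ℕ) (P : Plane) :
    Differentiable ℝ (a0 f n P) := by
  rw [show a0 f n P = _ from funext (a0_eq f n P)]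
  exact differentiable_zonalMean hf _ P

/-! ### The Euler equations for the Fourier coefficients -/

/-- This is `euler_divergenceMean` with weight `P_{2k+1}`, a multiple of `P_{2k+2}' - P_{2k}'`; the
weight `2 q + X q'` is then also a combination of these two derivatives. -/
theorem euler_divergenceMean_legendre (hf : ContDiff ℝ (⊤ : ℕ∞) f) (k : ℕ) (P : Plane) (t : ℝ) :
    t * deriv (divergenceMean f (derivative (legendre (2 * (k + 1)))) P) t +
        (2 * k + 3) * divergenceMean f (derivative (legendre (2 * (k + 1)))) P t =
      t * deriv (divergenceMean f (derivative (legendre (2 * k))) P) t -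
        2 * k * divergenceMean f (derivative (legendre (2 * k))) P t +
        (4 * k + 3) * t * zonalMean (horizontalLaplacian f) (legendre (2 * k + 1)) P t := by
  have hP : derivative (legendre (2 * (k + 1))) =
      C (4 * (k : ℝ) + 3) * legendre (2 * k + 1) + derivative (legendre (2 * k)) := by
    rw [show 2 * (k + 1) = 2 * k + 2 by ring, derivative_legendre_add_two]
    push_cast
    ring_nf
  have hX : C (4 * (k : ℝ) + 3) * (2 * legendre (2 * k + 1) +
      X * derivative (legendre (2 * k + 1))) =
      C (2 * (k : ℝ) + 3) * derivative (legendre (2 * (k + 1))) +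
        C (2 * (k : ℝ)) * derivative (legendre (2 * k)) := by
    have h1 := derivative_legendre_succ (2 * k + 1)
    rw [show 2 * k + 1 + 1 = 2 * (k + 1) by ring] at h1
    simp only [C_mul, C_add, map_natCast, C_1, map_ofNat] at h1 hP ⊢
    push_cast at h1
    linear_combination -(4 * (k : ℝ[X]) + 3) * h1 + 2 * (k : ℝ[X]) * hP
  have hfun : divergenceMean f (derivative (legendre (2 * (k + 1)))) P = fun t =>
      (4 * (k : ℝ) + 3) * divergenceMean f (legendre (2 * k + 1)) P t +
        divergenceMean f (derivative (legendre (2 * k))) P t := funext fun t => by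
    rw [hP, divergenceMean_add hf, divergenceMean_C_mul]
  have hder := (((differentiable_divergenceMean hf (legendre (2 * k + 1)) P
    t).hasDerivAt.const_mul (4 * (k : ℝ) + 3)).add
    (differentiable_divergenceMean hf (derivative (legendre (2 * k))) P t).hasDerivAt).deriv
  have hder' : deriv (divergenceMean f (derivative (legendre (2 * (k + 1)))) P) t = _ :=
    (congrArg (fun g => deriv g t) hfun).trans hder
  have hE := congrArg (fun q => divergenceMean f q P t) hX
  simp only [divergenceMean_add hf, divergenceMean_C_mul] at hE
  have hmain := euler_divergenceMean hf (legendre (2 * k + 1)) P t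
  rw [divergenceMean_add hf] at hmain
  rw [hder']
  linear_combination -(4 * (k : ℝ) + 3) * hmain - hE

/-- This is `euler_zonalMean` with weight `P_{2k+2}'`: `(1 - X²) P_{2k+2}'` equals `ρ (P_{2k+1} -
P_{2k+3})`, and the second weight is a combination of the same two polynomials. -/
theorem euler_zonalMean_legendre (hf : ContDiff ℝ (⊤ : ℕ∞) f) (k : ℕ) (P : Plane) (t : ℝ) :
    t * deriv (zonalMean f (legendre (2 * (k + 1) + 1)) P) t +
        (2 * k + 4) * zonalMean f (legendre (2 * (k + 1) + 1)) P t =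
      t * deriv (zonalMean f (legendre (2 * k + 1)) P) t -
        (2 * k + 1) * zonalMean f (legendre (2 * k + 1)) P t -
        t * ((4 * k + 5) / ((2 * k + 2) * (2 * k + 3)) *
          divergenceMean f (derivative (legendre (2 * (k + 1)))) P t) := by
  obtain ⟨ρ, hρ⟩ : ∃ ρ : ℝ, ρ = (2 * k + 2) * (2 * k + 3) / (4 * k + 5) := ⟨_, rfl⟩
  have hρ0 : ρ ≠ 0 := by rw [hρ]; positivity
  have hH : (1 - X ^ 2) * derivative (legendre (2 * (k + 1))) =
      C ρ * legendre (2 * k + 1) + C (-ρ) * legendre (2 * (k + 1) + 1) := by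
    have h := X_sq_sub_one_mul_derivative_legendre_succ (2 * k + 1)
    have h5 : (C (4 * (k : ℝ) + 5) : ℝ[X]) ≠ 0 := C_ne_zero.2 (by positivity)
    have hρ' : C ρ * C (4 * (k : ℝ) + 5) = C ((2 * (k : ℝ) + 2) * (2 * k + 3)) := by
      rw [← C_mul, hρ]; congr 1; field_simp
    refine mul_left_cancel₀ h5 ?_
    rw [show 2 * k + 1 + 1 = 2 * (k + 1) by ring, show 2 * k + 1 + 2 = 2 * (k + 1) + 1 by ring] at h
    simp only [C_mul, C_add, C_neg, map_natCast, C_1, map_ofNat] at h hρ' ⊢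
    push_cast at h
    linear_combination -h + (legendre (2 * (k + 1) + 1) - legendre (2 * k + 1)) * hρ'
  have hHX : (1 - X ^ 2) * derivative (legendre (2 * (k + 1))) +
      X * derivative ((1 - X ^ 2) * derivative (legendre (2 * (k + 1)))) =
      C (-(ρ * (2 * k + 1))) * legendre (2 * k + 1) +
        C (-(ρ * (2 * k + 4))) * legendre (2 * (k + 1) + 1) := by
    have h1 := derivative_legendre_succ (2 * k + 1)
    have h2 := derivative_legendre_succ (2 * (k + 1) + 1)
    have h3 := derivative_legendre_add_two (2 * (k + 1))
    rw [show 2 * k + 1 + 1 = 2 * (k + 1) by ring] at h1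
    rw [hH, derivative_add, derivative_C_mul, derivative_C_mul]
    simp only [C_mul, C_add, C_neg, map_natCast, C_1, map_ofNat] at h1 h2 h3 ⊢
    push_cast at h1 h2 h3
    linear_combination C ρ * (h2 - h3 - h1)
  have hmain := euler_zonalMean hf (derivative (legendre (2 * (k + 1)))) P t
  rw [hHX, hH, zonalMean_add hf, zonalMean_C_mul, zonalMean_C_mul] at hmain
  have hfun : zonalMean f (C ρ * legendre (2 * k + 1) + C (-ρ) * legendre (2 * (k + 1) + 1)) P =
      fun t => ρ * zonalMean f (legendre (2 * k + 1)) P t +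
        -ρ * zonalMean f (legendre (2 * (k + 1) + 1)) P t := funext fun t => by
    rw [zonalMean_add hf, zonalMean_C_mul, zonalMean_C_mul]
  have hder := (((differentiable_zonalMean hf (legendre (2 * k + 1)) P
    t).hasDerivAt.const_mul ρ).add
    ((differentiable_zonalMean hf (legendre (2 * (k + 1) + 1)) P t).hasDerivAt.const_mul (-ρ))).deriv
  have hder' : deriv (zonalMean f (C ρ * legendre (2 * k + 1) +
      C (-ρ) * legendre (2 * (k + 1) + 1)) P) t = _ := (congrArg (fun g => deriv g t) hfun).trans hder
  have hinv : (4 * (k : ℝ) + 5) / ((2 * k + 2) * (2 * k + 3)) = ρ⁻¹ := by rw [hρ, inv_div]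
  rw [hder'] at hmain
  rw [hinv]
  refine mul_left_cancel₀ hρ0 ?_
  have hc : ρ * ρ⁻¹ = 1 := mul_inv_cancel₀ hρ0
  linear_combination hmain +
    t * divergenceMean f (derivative (legendre (2 * (k + 1)))) P t * hc

/-! ### The representations -/

theorem legendre_representation (hf : ContDiff ℝ (⊤ : ℕ∞) f) (P : Plane) (k : ℕ) {t : ℝ}
    (ht : 0 < t) :
    1 / (4 * Real.pi) * zonalMean f (legendre (2 * k + 1)) P t = a0 f 1 P t / 3 +
      radialSum (cNormalized k) (k + 1) k (fun i => a0 (horizontalLaplacian^[i] f) 1 P) 0 t ∧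
    1 / (2 * Real.pi) * divergenceMean f (derivative (legendre (2 * k))) P t =
      t * radialSum (sNormalized k) k k (fun i => a0 (horizontalLaplacian^[i] f) 1 P) 1 t := by
  have hL := contDiff_iterate_horizontalLaplacian hf
  have h := radial_representation (v := fun i => a0 (horizontalLaplacian^[i] f) 1 P)
    (α := fun k i t => 1 / (4 * Real.pi) *
      zonalMean (horizontalLaplacian^[i] f) (legendre (2 * k + 1)) P t)
    (e := fun k i t => 1 / (2 * Real.pi) *
      divergenceMean (horizontalLaplacian^[i] f) (derivative (legendre (2 * k))) P t)
    (fun i => differentiable_a0 (hL i) 1 P)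
    (fun k i => (differentiable_zonalMean (hL i) _ P).const_mul _)
    (fun k i => (differentiable_divergenceMean (hL i) _ P).const_mul _)
    -- The normalizing factor of `a_{01}` is `3 / (4π)`, hence the initial value `v i / 3`.
    (fun i t => by
      rw [a0_eq, zonalMean_C_mul]
      push_cast
      ring)
    (fun i t => by
      have h0 : derivative (legendre (2 * 0)) = C 0 * 1 := by
        rw [mul_zero, legendre_zero]; simp
      rw [h0, divergenceMean_C_mul, zero_mul, mul_zero])
    (fun k i t _ => by
      have h := euler_divergenceMean_legendre (hL i) k P t
      rw [← Function.iterate_succ_apply' horizontalLaplacian] at h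
      simp only [deriv_const_mul_field]
      linear_combination 1 / (2 * Real.pi) * h)
    (fun k i t _ => by
      have h := euler_zonalMean_legendre (hL i) k P t
      simp only [deriv_const_mul_field]
      linear_combination 1 / (4 * Real.pi) * h) k
  exact ⟨h.1 0 t ht, h.2 0 t ht⟩

theorem continuous_cIntegrand (hf : ContDiff ℝ (⊤ : ℕ∞) f) (k : ℕ) (P : Plane) (t : ℝ) :
    Continuous (cIntegrand f k P t) := by
  have hv : ∀ i, Continuous fun u => a0 (horizontalLaplacian^[i] f) 1 P u := fun i =>
    (differentiable_a0 (contDiff_iterate_horizontalLaplacian hf i) 1 P).continuous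
  unfold cIntegrand
  simp only [lap_a0 hf]
  fun_prop

theorem continuous_sIntegrand (hf : ContDiff ℝ (⊤ : ℕ∞) f) (k : ℕ) (P : Plane) (t : ℝ) :
    Continuous (sIntegrand f k P t) := by
  have hv : ∀ i, Continuous fun u => a0 (horizontalLaplacian^[i] f) 1 P u := fun i =>
    (differentiable_a0 (contDiff_iterate_horizontalLaplacian hf i) 1 P).continuous
  unfold sIntegrand
  simp only [lap_a0 hf]
  fun_prop

theorem integral_mul_sum_pow {v : ℝ → ℝ} (hv : Continuous v) (κ : ℕ → ℝ) (M : Finset ℕ) (r : ℝ)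
    {t : ℝ} (ht : t ≠ 0) :
    ∫ u in (0 : ℝ)..t, r * ∑ m ∈ M, κ m * (u / t) ^ (2 * m + 1) * v u =
      r * ∑ m ∈ M, κ m * (t * radialMean m v t) := by
  rw [intervalIntegral.integral_const_mul, intervalIntegral.integral_finsetSum fun m _ =>
    Continuous.intervalIntegrable (by fun_prop) _ _]
  simp only [mul_assoc, intervalIntegral.integral_const_mul, integral_pow_mul_eq_radialMean _ _ ht]

theorem integral_cIntegrand (hf : ContDiff ℝ (⊤ : ℕ∞) f) (k : ℕ) (P : Plane) {t : ℝ} (ht : 0 < t) :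
    ∫ u in (0 : ℝ)..t, cIntegrand f (k + 1) P t u = (4 * k + 3) *
      radialSum (cNormalized k) (k + 1) k (fun i => a0 (horizontalLaplacian^[i] f) 1 P) 0 t := by
  have hv : ∀ i, Continuous fun u => a0 (horizontalLaplacian^[i] f) 1 P u := fun i =>
    (differentiable_a0 (contDiff_iterate_horizontalLaplacian hf i) 1 P).continuous
  simp only [cIntegrand, lap_a0 hf]
  rw [intervalIntegral.integral_finsetSum fun m _ =>
    Continuous.intervalIntegrable (by fun_prop) _ _, radialSum, Finset.mul_sum]
  refine Finset.sum_congr rfl fun i _ => ?_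
  rw [integral_mul_sum_pow (hv i) _ _ _ ht.ne', Nat.add_sub_cancel,
    show k + 1 + i - 1 = k + i by omega, Finset.mul_sum, Finset.mul_sum]
  refine Finset.sum_congr rfl fun m _ => ?_
  -- The exponent is `-1` at `i = 0`; the factor `t` from the substitution `u = t r` compensates it.
  have hz : t ^ (2 * (i : ℤ) - 1) * t = t ^ (2 * i) := by
    rw [← zpow_add_one₀ ht.ne', sub_add_cancel, ← zpow_natCast]
    push_cast
    rfl
  rw [← hz, cNormalized, zero_add]
  field_simp

theorem integral_sIntegrand (hf : ContDiff ℝ (⊤ : ℕ∞) f) (k : ℕ) (P : Plane) {t : ℝ}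
    (ht : 0 < t) :
    2 * k * (2 * k + 1) / (4 * k + 1) * ∫ u in (0 : ℝ)..t, sIntegrand f (k + 1) P t u =
      t * radialSum (sNormalized k) k k (fun i => a0 (horizontalLaplacian^[i] f) 1 P) 1 t := by
  have hv : ∀ i, Continuous fun u => a0 (horizontalLaplacian^[i] f) 1 P u := fun i =>
    (differentiable_a0 (contDiff_iterate_horizontalLaplacian hf i) 1 P).continuous
  simp only [sIntegrand, lap_a0 hf]
  rw [intervalIntegral.integral_finsetSum fun m _ =>
    Continuous.intervalIntegrable (by fun_prop) _ _, radialSum, Finset.mul_sum, Finset.mul_sum,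
    Nat.add_sub_cancel, ← Finset.Ico_succ_right_eq_Icc, Finset.sum_Ico_eq_sum_range]
  refine Finset.sum_congr (by simp) fun i _ => ?_
  rw [integral_mul_sum_pow (hv _) _ _ _ ht.ne', show k + 1 + (1 + i) - 2 = k + i by omega,
    show 1 + i - 1 = i by omega, Finset.mul_sum, Finset.mul_sum, Finset.mul_sum]
  refine Finset.sum_congr rfl fun m _ => ?_
  rw [sNormalized]
  ring

theorem sectoralFactor_two_mul {k : ℕ} (hk : k ≠ 0) :
    sectoralFactor (2 * k) = (4 * k + 1) / (2 * k * (2 * k + 1)) * (1 / (2 * Real.pi)) := by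
  obtain ⟨n, hn⟩ : ∃ n, 2 * k = n + 1 := ⟨2 * k - 1, by omega⟩
  have hn' : 2 * (k : ℝ) = n + 1 := by exact_mod_cast hn
  rw [sectoralFactor, hn, Nat.add_sub_cancel, Nat.factorial_succ (n + 1), Nat.factorial_succ n, hn',
    show 4 * (k : ℝ) = 2 * (n + 1) by linarith]
  push_cast
  field_simp

end

end SphericalMeans

end

/-! ### The theorem -/

theorem theorem3 (f : SphericalMeans.Space → ℝ) (hf : ContDiff ℝ (⊤ : ℕ∞) f) :
    -- the derivatives of the coefficients that occur below exist
    (∀ u : ℝ, 0 < u → ContDiff ℝ (⊤ : ℕ∞) (fun P => SphericalMeans.a0 f 1 P u)) ∧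
    (∀ k : ℕ, 1 < k → ∀ t : ℝ, 0 < t →
      Differentiable ℝ (fun P => SphericalMeans.a f 1 (2 * k - 2) P t) ∧
      Differentiable ℝ (fun P => SphericalMeans.b f 1 (2 * k - 2) P t)) ∧
    -- the representation of the odd coefficients
    (∀ k : ℕ, 0 < k → ∀ (P : SphericalMeans.Plane) (t : ℝ), 0 < t →
      IntervalIntegrable (SphericalMeans.cIntegrand f k P t) MeasureTheory.volume 0 t ∧
      SphericalMeans.a0 f (2 * k - 1) P t =
        (4 * (k : ℝ) - 1) / 3 * SphericalMeans.a0 f 1 P t +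
          ∫ u in (0 : ℝ)..t, SphericalMeans.cIntegrand f k P t u) ∧
    -- the representation of the divergence of the even coefficients
    (∀ k : ℕ, 1 < k → ∀ (P : SphericalMeans.Plane) (t : ℝ), 0 < t →
      IntervalIntegrable (SphericalMeans.sIntegrand f k P t) MeasureTheory.volume 0 t ∧
      SphericalMeans.partialP (fun Q => SphericalMeans.a f 1 (2 * k - 2) Q t) P +
        SphericalMeans.partialQ (fun Q => SphericalMeans.b f 1 (2 * k - 2) Q t) P =
          ∫ u in (0 : ℝ)..t, SphericalMeans.sIntegrand f k P t u) := by
  open SphericalMeans in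
  refine ⟨fun u _ => ?_, fun k _ t _ => ⟨?_, ?_⟩, fun k hk P t ht =>
    ⟨(continuous_cIntegrand hf k P t).intervalIntegrable _ _, ?_⟩, fun k hk P t ht =>
    ⟨(continuous_sIntegrand hf k P t).intervalIntegrable _ _, ?_⟩⟩
  · simp only [a0_eq]
    exact contDiff_weightedMean hf (contDiff_eval_coord _) u
  · simp only [a_one_eq]
    exact differentiable_weightedMean hf (contDiff_coord_mul_eval 0 _) t
  · simp only [b_one_eq]
    exact differentiable_weightedMean hf (contDiff_coord_mul_eval 1 _) t
  · obtain ⟨k, rfl⟩ := Nat.exists_eq_succ_of_ne_zero hk.ne'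
    have h := (legendre_representation hf P k ht).1
    rw [Nat.succ_eq_add_one, integral_cIntegrand hf k P ht,
      show 2 * (k + 1) - 1 = 2 * k + 1 by omega, a0_eq f (2 * k + 1), zonalMean_C_mul]
    push_cast
    linear_combination (4 * (k : ℝ) + 3) * h
  -- After the shift of `k` by one the hypothesis becomes `k ≠ 0`, so the normalizing factor `2k
  -- (2k+1) / (4k+1)` is nonzero and cancels.
  · obtain ⟨k, rfl⟩ := Nat.exists_eq_succ_of_ne_zero (by omega : k ≠ 0)
    have hk0 : k ≠ 0 := by omega
    have hk' : (k : ℝ) ≠ 0 := by exact_mod_cast hk0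
    have h := (legendre_representation hf P k ht).2
    rw [Nat.succ_eq_add_one, show 2 * (k + 1) - 2 = 2 * k by omega,
      partialP_a_add_partialQ_b hf, sectoralFactor_two_mul hk0, mul_assoc, h,
      ← integral_sIntegrand hf k P ht, ← mul_assoc, div_mul_div_comm, mul_comm (4 * (k : ℝ) + 1),
      div_self (by positivity), one_mul]
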